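/- Let $\mathbb F$ be a field, let $a,b\ge 1$ be coprime integers, $d\in\mathbb F\setminus\{0\}$, and let $X$ be the Miura–Kamiya curve $y^a+\sum_{ai+bj<ab}c_{i,j}x^iy^j+dx^b=0$ over $\mathbb F$, with coordinate ring $R=\mathbb F[x,y]$. The monomials $x^iy^j$ ($i\ge 0$, $0\le j<a$) form an $\mathbb F$-basis of $R$. For $0\ne f\in R$ let $\delta(f)$ be the largest $ai+bj$ such that $x^iy^j$ ($j<a$) occurs in $f$ (the pole order of $f$ at the point at infinity), and put $\delta(0)=-\infty$. Let $S=\{ai+bj\mid i,j\ge 0\}$ (its elements are called nongaps); for $s\in S$ let $\phi_s$ be the unique monomial with $\delta(\phi_s)=s$. Write $\mathrm{lm}(f)=\phi_{\delta(f)}$, and let $\mathrm{lc}(f)$ be the coefficient of $\mathrm{lm}(f)$ in $f$. Say that $\phi_s$ divides $\phi_t$ if $t-s\in S$; the lcms of two monomials are their common multiples that are minimal for divisibility (one or two monomials). For an ideal $I$ of $R$ let $\Delta(I)$ be the set of the monomials that are not of the form $\mathrm{lm}(f)$, $0\neq f\in I$. For a set $T\subset R$ let $\Sigma(T)$ be the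 set of the monomials divisible by $\mathrm{lm}(f)$ for some $0\ne f\in T$, and $\Delta(T)$ its complement in the set of monomials. A Gröbner basis of $I$ is a set of nonzero elements of $I$ such that $\mathrm{lm}(f)$ is divisible by the leading monomial of one of them for every $0\neq f\in I$. Let $P_1,\dots,P_n$ be distinct $\mathbb F$-rational points of the affine curve $X$, let $J=\bigcap_i\mathfrak m_i$ be the intersection of their maximal ideals, and $\mathrm{ev}(f)=(f(P_1),\dots,f(P_n))$ for $f\in R$. Let $u<n$ be a non-negative integer. A message $(\omega_s)_{s\in S,\,s\le u}$ is encoded as $c=\mathrm{ev}(\mu)$ with $\mu=\sum_{s\in S,\,s\le u}\omega_s\phi_s$, and $v=c+e$ with $e\in\mathbb F^n$ is received; $\mathrm{wt}(e)$ is the number of nonzero entries of $e$. Elements of $Rz\oplus R$ are written $f=f^Uz+f^D$. For an integer $s$, the order $>_s$ on the monomials $\phi_tz,\phi_t$ of $Rz\oplus R$ compares the weights $t+s$ of $\phi_tz$ and $t$ of $\phi_t$, and breaks ties in favour of the higher $z$-degree; $\mathrm{lm}_s(f)$ and $\mathrm{lt}_s(f)$ are the leading monomial and the leading term for $>_s$.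 For a finite set $B\subset Rz\oplus R$ of nonzero elements, $G_i$ and $F_j$ denote its elements with $\mathrm{lm}_s$ in $R$ and in $Rz$, respectively. For a monomial $\psi$ of $R$ and $f$ with leading term in $R$ such that the leading monomial of $f$ divides $\psi$, $\psi/\mathrm{lt}(f)$ is the scalar multiple $\lambda$ of a monomial of $R$ such that $\lambda f^D$ has leading term $\psi$. The interpolation decoding algorithm runs as follows. *Initialize:* choose $h\in R$ with $\mathrm{ev}(h)=v$ and a finite Gröbner basis $\{\eta_i\}$ of $J$; let $N=\delta(h)$, $B^{(N)}=\{\eta_i\}\cup\{z-h\}$, and $w^{(s)}=0$ for all $s$. *Main:* for $s=N,N-1,\dots,0$ (no iteration if $h=0$), with $B^{(s)}=\{G_i,F_j\}$: *M1.* If $s\in S$ and $s\le u$, let $w_j=-\kappa_j/\mathrm{lc}(F_j^U\phi_s)$, where $\kappa_j$ is the coefficient of $\mathrm{lm}(F_j^U\phi_s)$ in $F_j^D$; for each $c\in W=\{w_j\}$ let $d_c=\bigl|\bigcup_{w_j=c}\Sigma(\{F_j^U\phi_s\})\cap\Delta(\{G_i^D\})\bigr|$; let $w^{(s)}$ be an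 element $c\in W$ with largest $d_c$; and let $\tilde B=\{f(z+w^{(s)}\phi_s)\mid f\in B^{(s)}\}$. Otherwise let $\tilde B=B^{(s)}$. *M2.* Write $\tilde B=\{\tilde G_i,\tilde F_j\}$. Put $\mathrm{spoly}(\tilde F_j)=\{\tilde F_j\}$ if $\mathrm{lm}_{s-1}(\tilde F_j)\in Rz$. If $\mathrm{lm}_{s-1}(\tilde F_j)\in R$ is divisible by some $\mathrm{lm}_s(\tilde G_i)$, choose one such $i$ and let $\mathrm{spoly}(\tilde F_j)$ consist of the element $\frac{\psi}{\mathrm{lt}_{s-1}(\tilde F_j)}\tilde F_j-\frac{\psi}{\mathrm{lt}_s(\tilde G_i)}\tilde G_i$ with $\psi=\mathrm{lm}_{s-1}(\tilde F_j)$. If $\mathrm{lm}_{s-1}(\tilde F_j)\in R$ is divisible by no $\mathrm{lm}_s(\tilde G_i)$, let $\mathrm{spoly}(\tilde F_j)$ be the set of these elements for all $i$ and all lcms $\psi$ of $\mathrm{lm}_{s-1}(\tilde F_j)$ and $\mathrm{lm}_s(\tilde G_i)$. Then $B^{(s-1)}$ is the union of the set of all $\tilde G_i$ and of those $\tilde F_j$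 for which $\mathrm{lm}_{s-1}(\tilde F_j)\in R$ is divisible by no $\mathrm{lm}_s(\tilde G_i)$, and of the set $\bigcup_j\mathrm{spoly}(\tilde F_j)$, after each of these two sets has been reduced by removing elements whose leading monomial for $>_{s-1}$ is divisible by that of another remaining element, until there are no more such elements. *Output:* $(w^{(s)}\mid s\in S,\ s\le u)$. **Theorem.** For $s\in S$ let $\nu(s)=|\Delta(J)\cup\Delta(R\phi_s)|-s$, and let $d_u=\min_{s\in S,\,s\le u}\nu(s)$. If $d_u>2\,\mathrm{wt}(e)$, then the algorithm can be carried out (initial data exist, and no iteration gets stuck), and, whatever choices are made, it outputs $w^{(s)}=\omega_s$ for all $s\in S$, $s\le u$. Moreover, $d_u\ge n-u$ (without the condition on $e$). -/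

import Mathlib

open Polynomial

noncomputable section

/-- The data of a Miura–Kamiya curve
`y ^ a + ∑_{a i + b j < a b} c i j x ^ i y ^ j + d x ^ b = 0` over the field `F`. -/
structure MiuraKamiyaCurve (F : Type*) [Field F] where
  a : ℕ
  b : ℕ
  a_pos : 0 < a
  b_pos : 0 < b
  coprime : Nat.Coprime a b
  c : ℕ → ℕ → F
  d : F
  d_ne_zero : d ≠ 0

/-- Monomials of `R z ⊕ R`: `up t` is `φ_t z` and `down t` is `φ_t`, for a nongap `t`. -/
inductive Mono where
  | up (t : ℕ)
  | down (t : ℕ)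

namespace Mono

/-- The weighted degree of a monomial when `z` has weight `s`. -/
def weight (s : ℤ) : Mono → ℤ
  | up t => t + s
  | down t => t

def zdeg : Mono → ℕ
  | up _ => 1
  | down _ => 0

/-- The monomial order `≤_s`: compare weighted degrees, ties are broken by the `z`-degree. -/
def le (s : ℤ) (m m' : Mono) : Prop :=
  m.weight s < m'.weight s ∨ (m.weight s = m'.weight s ∧ m.zdeg ≤ m'.zdeg)

/-- The index of the monomial of `R` that occurs in the monomial. -/
def idx : Mono → ℕ
  | up t => t
  | down t => t

end Mono

namespace MiuraKamiyaCurve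

variable {F : Type*} [Field F] (X : MiuraKamiyaCurve F)

/-- The terms of the equation of the curve other than `y ^ a`, as a polynomial in `y` with
coefficients in `F[x]`. -/
def tail : F[X][X] :=
  (∑ j ∈ Finset.range X.a, ∑ i ∈ Finset.range X.b,
    if X.a * i + X.b * j < X.a * X.b then
      Polynomial.C (Polynomial.C (X.c i j) * Polynomial.X ^ i) * Polynomial.X ^ j else 0) +
    Polynomial.C (Polynomial.C X.d * Polynomial.X ^ X.b)

/-- The equation of the curve, as a polynomial in `y` with coefficients in `F[x]`. -/
def poly : F[X][X] := Polynomial.X ^ X.a + X.tail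

theorem tail_degree_lt : X.tail.degree < X.a := by
  have ha : (0 : WithBot ℕ) < X.a := by exact_mod_cast X.a_pos
  refine lt_of_le_of_lt (degree_add_le _ _) (max_lt ?_ (lt_of_le_of_lt degree_C_le ha))
  refine lt_of_le_of_lt (degree_sum_le _ _) ((Finset.sup_lt_iff (by simp)).2 ?_)
  intro j hj
  refine lt_of_le_of_lt (degree_sum_le _ _) ((Finset.sup_lt_iff (by simp)).2 ?_)
  intro i _
  split_ifs
  · refine lt_of_le_of_lt (degree_C_mul_X_pow_le _ _) ?_
    exact_mod_cast Finset.mem_range.1 hj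
  · simp

theorem monic_poly : X.poly.Monic := monic_X_pow_add X.tail_degree_lt

/-- The coordinate ring `R = F[x, y]` of the curve. -/
abbrev R : Type _ := AdjoinRoot X.poly

/-- The function `x` in `R`. -/
def x : X.R := AdjoinRoot.of X.poly Polynomial.X

/-- The function `y` in `R`. -/
def y : X.R := AdjoinRoot.root X.poly

/-- Constants in `R`. -/
def const (c : F) : X.R := AdjoinRoot.of X.poly (Polynomial.C c)

/-- The semigroup `S = ⟨a, b⟩` of nongaps. -/
def S : Set ℕ := {t | ∃ i j : ℕ, t = X.a * i + X.b * j}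

/-- The exponent `j` of `y` in `φ_s = x ^ i y ^ j`, namely `b' s mod a` with `b' b ≡ 1 mod a`. -/
def expY (s : ℕ) : ℕ := (((X.b : ZMod X.a)⁻¹ * (s : ZMod X.a) : ZMod X.a)).val

/-- The exponent `i` of `x` in `φ_s = x ^ i y ^ j`, namely `(s - b j) / a`. -/
def expX (s : ℕ) : ℕ := (s - X.b * X.expY s) / X.a

/-- For a nongap `s`, the unique monomial `x ^ i y ^ j`, `j < a`, with `a i + b j = s`. -/
def phi (s : ℕ) : X.R := X.x ^ X.expX s * X.y ^ X.expY s

/-- The normal form of an element of `R`: the representative of degree `< a` in `y`. -/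
def normalForm (f : X.R) : F[X][X] := AdjoinRoot.modByMonicHom X.monic_poly f

/-- For a nongap `s`, the coefficient of the monomial `φ_s` in `f`. -/
def coeff (f : X.R) (s : ℕ) : F := ((X.normalForm f).coeff (X.expY s)).coeff (X.expX s)

/-- The pole order `δ(f)` at infinity of `f ≠ 0`: the largest `a i + b j` such that
`x ^ i y ^ j`, `j < a`, occurs in `f`. The value at `f = 0` is `0` and is not used. -/
def delta (f : X.R) : ℕ :=
  (X.normalForm f).support.sup fun j =>
    ((X.normalForm f).coeff j).support.sup fun i => X.a * i + X.b * j

/-- The leading coefficient of an element of `R`. -/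
def lc (f : X.R) : F := X.coeff f (X.delta f)

/-- `s` divides `t`, for nongaps: `t - s` is a nongap. -/
def Dvd (s t : ℕ) : Prop := ∃ r ∈ X.S, t = s + r

/-- `l` is a common multiple of the nongaps `s` and `t`. -/
def IsCommonMultiple (s t l : ℕ) : Prop := X.Dvd s l ∧ X.Dvd t l

/-- `l` is an lcm of the nongaps `s` and `t`: a common multiple that is minimal for
divisibility. -/
def IsLcm (s t l : ℕ) : Prop :=
  X.IsCommonMultiple s t l ∧ ∀ l', X.IsCommonMultiple s t l' → X.Dvd l' l → l' = l

/-- The leading monomials of the nonzero elements of an ideal (`φ_t` is represented by `t`). -/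
def sigma (I : Ideal X.R) : Set ℕ := {t | ∃ f ∈ I, f ≠ 0 ∧ X.delta f = t}

/-- The monomials of `R` that are not in `sigma I`. -/
def Delta (I : Ideal X.R) : Set ℕ := X.S \ X.sigma I

/-- The monomials of `R` divisible by the leading monomial of some nonzero element of `T`. -/
def sigmaGen (T : Set X.R) : Set ℕ := {t | ∃ f ∈ T, f ≠ 0 ∧ X.Dvd (X.delta f) t}

/-- The monomials of `R` that are not in `sigmaGen T`. -/
def DeltaGen (T : Set X.R) : Set ℕ := X.S \ X.sigmaGen T

/-- A Gröbner basis of an ideal of `R`. -/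
def IsGroebnerBasis (I : Ideal X.R) (η : Set X.R) : Prop :=
  (∀ g ∈ η, g ∈ I ∧ g ≠ 0) ∧ ∀ f ∈ I, f ≠ 0 → ∃ g ∈ η, X.Dvd (X.delta g) (X.delta f)

/-! ### Points and codes -/

/-- The (affine) rational points of the curve. -/
def Point : Type _ := {p : F × F // X.poly.evalEval p.1 p.2 = 0}

/-- The value of a function at a rational point. -/
def evalAt (p : X.Point) (f : X.R) : F := AdjoinRoot.evalEval p.2 f

/-- The maximal ideal `⟨x - α, y - β⟩` of the point `(α, β)`. -/
def maxIdeal (p : X.Point) : Ideal X.R :=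
  Ideal.span {X.x - X.const p.1.1, X.y - X.const p.1.2}

variable {n : ℕ}

def ev (P : Fin n ↪ X.Point) (f : X.R) : Fin n → F := fun i => X.evalAt (P i) f

/-- The ideal `J` of the set of points. -/
def J (P : Fin n ↪ X.Point) : Ideal X.R := ⨅ i, X.maxIdeal (P i)

open Classical in
/-- The nongaps `≤ u`. -/
def nongapsLE (u : ℕ) : Finset ℕ := (Finset.range (u + 1)).filter (· ∈ X.S)

theorem nongapsLE_nonempty (u : ℕ) : (X.nongapsLE u).Nonempty :=
  ⟨0, by simp only [nongapsLE, Finset.mem_filter]; exact ⟨by simp, 0, 0, by simp⟩⟩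

/-- The function `μ = ∑ ω_s φ_s` over the nongaps `s ≤ u`. -/
def message (u : ℕ) (ω : ℕ → F) : X.R := ∑ s ∈ X.nongapsLE u, X.const (ω s) * X.phi s

/-- `ν(s) = |Δ(J) ∪ Δ(R φ_s)| - s`. -/
def nu (P : Fin n ↪ X.Point) (s : ℕ) : ℤ :=
  ((X.Delta (X.J P) ∪ X.Delta (Ideal.span {X.phi s})).ncard : ℤ) - s

/-- `d_u`, the minimum of `ν(s)` over the nongaps `s ≤ u`. -/
def du (P : Fin n ↪ X.Point) (u : ℕ) : ℤ :=
  (X.nongapsLE u).inf' (X.nongapsLE_nonempty u) (X.nu P)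

/-! ### Leading monomials in `R z ⊕ R`

An element `f = f^U z + f^D` is the pair `(f^U, f^D)`. -/

/-- The coefficient of a monomial in an element of `R z ⊕ R`. -/
def coeff₂ (f : X.R × X.R) : Mono → F
  | .up t => X.coeff f.1 t
  | .down t => X.coeff f.2 t

/-- The monomials that occur in an element of `R z ⊕ R`. -/
def supp (f : X.R × X.R) : Set Mono := {m | m.idx ∈ X.S ∧ X.coeff₂ f m ≠ 0}

/-- `m` is the leading monomial `lm_s(f)` of `f` with respect to `>_s`. -/
def IsLM (s : ℤ) (f : X.R × X.R) (m : Mono) : Prop :=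
  m ∈ X.supp f ∧ ∀ m' ∈ X.supp f, Mono.le s m' m

/-- Divisibility of monomials of `R z ⊕ R`. -/
def MonoDvd : Mono → Mono → Prop
  | .up t, .up t' => X.Dvd t t'
  | .down t, .down t' => X.Dvd t t'
  | _, _ => False

/-- The elements `F_j` of `B`: those with `lm_s` in `R z`. -/
def upPart (s : ℤ) (B : Set (X.R × X.R)) : Set (X.R × X.R) :=
  {f | f ∈ B ∧ ∃ t, X.IsLM s f (.up t)}

/-- The elements `G_i` of `B`: those with `lm_s` in `R`. -/
def downPart (s : ℤ) (B : Set (X.R × X.R)) : Set (X.R × X.R) :=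
  {f | f ∈ B ∧ ∃ t, X.IsLM s f (.down t)}

/-- The monomials of `R z ⊕ R` that are divisible by no leading monomial `lm_s(g)`, `g ∈ T`. -/
def DeltaGen₂ (s : ℤ) (T : Set (X.R × X.R)) : Set Mono :=
  {m | m.idx ∈ X.S ∧ ∀ g ∈ T, ∀ p, X.IsLM s g p → ¬ X.MonoDvd p m}

/-! ### Step M1: message guessing -/

/-- The substitution `f ↦ f(z + w φ_s)`. -/
def shift (s : ℕ) (w : F) (f : X.R × X.R) : X.R × X.R :=
  (f.1, f.2 + X.const w * X.phi s * f.1)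

/-- The value `w_j` of `F_j = f`: minus the coefficient in `f^D` of the monomial
`lm(f^U φ_s)`, divided by the leading coefficient of `f^U φ_s`. -/
def vote (s : ℕ) (f : X.R × X.R) : F :=
  -(X.coeff f.2 (X.delta (f.1 * X.phi s)) / X.lc (f.1 * X.phi s))

/-- The set `W` of all `w_j`. -/
def W (s : ℕ) (B : Set (X.R × X.R)) : Set F := X.vote s '' X.upPart s B

/-- The number `d_c = |⋃_{w_j = c} Σ(F_j^U φ_s) ∩ Δ({G_i^D})|`. -/
def dc (s : ℕ) (B : Set (X.R × X.R)) (c : F) : ℕ :=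
  (⋃ f ∈ {f | f ∈ X.upPart s B ∧ X.vote s f = c},
    X.sigmaGen {f.1 * X.phi s} ∩ X.DeltaGen (Prod.snd '' X.downPart s B)).ncard

/-- `c` is an admissible guess: an element of `W` with largest `d_c`. -/
def IsGuess (s : ℕ) (B : Set (X.R × X.R)) (c : F) : Prop :=
  c ∈ X.W s B ∧ ∀ c' ∈ X.W s B, X.dc s B c' ≤ X.dc s B c

/-! ### Step M2: Gröbner basis update -/

/-- The quotient `φ_l / lt(g)`: the scalar multiple `λ` of `φ_{l - δ(g)}` for which
`λ g` has leading term `φ_l`. -/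
def quotTerm (l : ℕ) (g : X.R) : X.R :=
  X.const (X.lc (X.phi (l - X.delta g) * g))⁻¹ * X.phi (l - X.delta g)

/-- The combination `(φ_l / lt(f)) f - (φ_l / lt(g)) g` for `f`, `g` whose leading terms are
those of `f^D`, `g^D`. -/
def scomb (l : ℕ) (f g : X.R × X.R) : X.R × X.R :=
  X.quotTerm l f.2 • f - X.quotTerm l g.2 • g

/-- `A` is an admissible value of `spoly(f)`, for the passage from `>_s` to `>_{s-1}`, where
`G` is the set of the `G_i`. If `lm_{s-1}(f)` is a multiple of some `lm_s(G_i)`, then one such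
`i` is chosen. -/
def IsSpoly (s : ℤ) (G : Set (X.R × X.R)) (f : X.R × X.R) (A : Set (X.R × X.R)) : Prop :=
  (∃ t, X.IsLM (s - 1) f (.up t) ∧ A = {f}) ∨
  (∃ t, X.IsLM (s - 1) f (.down t) ∧
    ∃ g ∈ G, ∃ p, X.IsLM s g (.down p) ∧ X.Dvd p t ∧ A = {X.scomb t f g}) ∨
  (∃ t, X.IsLM (s - 1) f (.down t) ∧ Mono.down t ∈ X.DeltaGen₂ s G ∧
    A = {h | ∃ g ∈ G, ∃ p l, X.IsLM s g (.down p) ∧ X.IsLcm t p l ∧ h = X.scomb l f g})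

/-- `A'` arises from `A` by removing elements whose leading term (for `>_s`) is divisible by
that of another element, until none is left. -/
def IsReduction (s : ℤ) (A A' : Set (X.R × X.R)) : Prop :=
  A' ⊆ A ∧
  (∀ f ∈ A, ∃ g ∈ A', ∃ m p, X.IsLM s f m ∧ X.IsLM s g p ∧ X.MonoDvd p m) ∧
  (∀ f ∈ A', ∀ g ∈ A', ∀ m p, X.IsLM s f m → X.IsLM s g p → X.MonoDvd p m → g = f)

/-- `B'` is an admissible result of step M2 applied to `B`. -/
def IsUpdate (s : ℤ) (B B' : Set (X.R × X.R)) : Prop :=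
  ∃ (A : X.R × X.R → Set (X.R × X.R)) (B₁ B₂ : Set (X.R × X.R)),
    (∀ f ∈ X.upPart s B, X.IsSpoly s (X.downPart s B) f (A f)) ∧
    X.IsReduction (s - 1)
      (X.downPart s B ∪ {f | f ∈ X.upPart s B ∧
        ∃ t, X.IsLM (s - 1) f (.down t) ∧ Mono.down t ∈ X.DeltaGen₂ s (X.downPart s B)}) B₁ ∧
    X.IsReduction (s - 1) (⋃ f ∈ X.upPart s B, A f) B₂ ∧
    B' = B₁ ∪ B₂

/-! ### The algorithm -/

/-- A state of the algorithm: the index `s` of the iteration to be carried out next, the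
current basis `B^{(s)}`, and the coefficients `w^{(t)}` guessed so far (`0` where no guess has
been made). The algorithm stops when `s < 0`. -/
structure State where
  s : ℤ
  B : Set (X.R × X.R)
  w : ℕ → F

/-- The initial states for the received vector `v`: the basis is `{η_i} ∪ {z - h}` with
`ev h = v`, where `{η_i}` is a finite Gröbner basis of `J`, and `s = δ(h)`; there is no iteration
if `h = 0`. -/
def IsInit (P : Fin n ↪ X.Point) (v : Fin n → F) (σ : X.State) : Prop :=
  ∃ (h : X.R) (η : Set X.R), X.ev P h = v ∧ η.Finite ∧ X.IsGroebnerBasis (X.J P) η ∧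
    σ.B = (fun g => ((0 : X.R), g)) '' η ∪ {((1 : X.R), -h)} ∧
    ((h = 0 ∧ σ.s = -1) ∨ (h ≠ 0 ∧ σ.s = X.delta h)) ∧
    σ.w = 0

/-- One iteration, consisting of M1 and M2. -/
def Step (u : ℕ) (σ σ' : X.State) : Prop :=
  ∃ (k : ℕ) (B : Set (X.R × X.R)), σ.s = k ∧ σ'.s = k - 1 ∧
    ((k ∈ X.S ∧ k ≤ u ∧ ∃ c, X.IsGuess k σ.B c ∧ B = X.shift k c '' σ.B ∧
        σ'.w = Function.update σ.w k c) ∨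
      (¬ (k ∈ X.S ∧ k ≤ u) ∧ B = σ.B ∧ σ'.w = σ.w)) ∧
    X.IsUpdate k B σ'.B

end MiuraKamiyaCurve

end

/-! Everything rests on one count. If a set of monomials is ranked injectively, the indices that
never lead an element of the kernel of a surjection onto `W` index a basis of `W`
(`ncard_not_lead_ker`). So exactly `A.card` monomials are missing for the ideal of a set `A` of
points (`Delta_vanishing`), and exactly `n` for the module of all `f` in `Rz ⊕ R` that vanish at the
points when `z` takes given values (`ncard_not_lead_interp`). A subset of that module whose leading
monomials leave out at most `n` monomials is therefore a Gröbner basis (`interp_groebner`); no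
S-pair criterion is needed.

The decoder keeps such a basis for the word "error plus the still unknown part of the message". Step
M1 substitutes `z + w φ_s`, which changes no leading monomial (`isLM_shift`). Step M2 pays for every
monomial newly missing in `Rz` with one that is no longer missing in `R` (`IsUpdate.ncard_le`). So
the bound `n` persists.

The guess is correct by a majority count (`vote_majority`). Let `U` and `D` be the missing monomials
in `Rz` and in `R`, so `|U| + |D| = n`, and let `V` be the ideal of the error-free positions, so
`|Δ(V)| = n - wt(e)`. Elements with a wrong vote contribute only to `D \ Δ(V)`, which has `wt(e) -
|U|` elements. The correct value collects at least `ν(s) - wt(e) - |U|`. It wins strictly as soon as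
`ν(s) > 2 wt(e)`.

If the interpolating function `h` has small pole order, some message coefficients are never guessed;
they vanish because codewords have weight at least `ν` (`nu_le_hammingNorm`, `eq_zero_of_ev_eq`).
The bound `d_u ≥ n - u` holds because `Δ(J)` alone has `n` elements. -/

noncomputable section

/-! ### Leading monomials and codimension -/

section Leading

variable {K V W ι : Type*} [Field K] [AddCommGroup V] [Module K V] [AddCommGroup W] [Module K W]

/-- `i` is the leading index of `v`, when `v` has coefficients `c v i`, `i ∈ M`, and the indices
are ranked by `rk`. -/
def IsLeadIndex (M : Set ι) (c : V →ₗ[K] ι → K) (rk : ι → ℕ) (v : V) (i : ι) : Prop :=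
  (i ∈ M ∧ c v i ≠ 0) ∧ ∀ j, j ∈ M ∧ c v j ≠ 0 → rk j ≤ rk i

variable {M : Set ι} {c : V →ₗ[K] ι → K} {rk : ι → ℕ}

theorem exists_isLeadIndex (hinj : ∀ v, (∀ i ∈ M, c v i = 0) → v = 0)
    (hfin : ∀ v, {i | i ∈ M ∧ c v i ≠ 0}.Finite) {v : V} (hv : v ≠ 0) :
    ∃ i, IsLeadIndex M c rk v i := by
  have hne : {i | i ∈ M ∧ c v i ≠ 0}.Nonempty := by
    by_contra h
    rw [Set.not_nonempty_iff_eq_empty] at h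
    refine hv (hinj v fun i hi => ?_)
    by_contra h0
    have : i ∈ {i | i ∈ M ∧ c v i ≠ 0} := ⟨hi, h0⟩
    simp [h] at this
  obtain ⟨i, hi, hmax⟩ := Set.exists_max_image _ rk (hfin v) hne
  exact ⟨i, hi, hmax⟩

/-- The indices that are not leading indices of elements of the kernel of `L` index a basis of the
target of `L`. -/
theorem ncard_not_lead_ker (hinj : ∀ v, (∀ i ∈ M, c v i = 0) → v = 0)
    (hfin : ∀ v, {i | i ∈ M ∧ c v i ≠ 0}.Finite) (e : ι → V)
    (he : ∀ i ∈ M, ∀ j ∈ M, c (e i) j = Set.indicator {i} 1 j)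
    (hrk : Function.Injective rk) (L : V →ₗ[K] W) (hL : Function.Surjective L)
    [Module.Finite K W] :
    {i | i ∈ M ∧ ¬ ∃ v, L v = 0 ∧ IsLeadIndex M c rk v i}.Finite ∧
    {i | i ∈ M ∧ ¬ ∃ v, L v = 0 ∧ IsLeadIndex M c rk v i}.ncard = Module.finrank K W := by
  classical
  set Δ := {i | i ∈ M ∧ ¬ ∃ v, L v = 0 ∧ IsLeadIndex M c rk v i} with hΔ
  have hcoef : ∀ (l : Δ →₀ K) (j : Δ), c (Finsupp.linearCombination K (fun i : Δ => e i) l) j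
      = l j := by
    intro l j
    rw [Finsupp.linearCombination_apply, Finsupp.sum, map_sum, Finset.sum_apply]
    rw [Finset.sum_eq_single j]
    · simp [he j j.2.1 j j.2.1]
    · intro i _ hij
      have : (j : ι) ≠ i := fun h => hij (Subtype.ext h.symm)
      simp [he i i.2.1 j j.2.1, this]
    · intro hj
      simp [Finsupp.notMem_support_iff.1 hj]
  have hcoef' : ∀ (l : Δ →₀ K), ∀ j ∈ M, j ∉ Δ →
      c (Finsupp.linearCombination K (fun i : Δ => e i) l) j = 0 := by
    intro l j hjM hj
    rw [Finsupp.linearCombination_apply, Finsupp.sum, map_sum, Finset.sum_apply]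
    refine Finset.sum_eq_zero fun i _ => ?_
    have : j ≠ i := fun h => hj (h ▸ i.2)
    simp [he i i.2.1 j hjM, this]
  -- A nontrivial relation would give a nonzero kernel element supported on `Δ`; its leading index
  -- would lie in `Δ`, against the definition.
  have hli : LinearIndependent K (fun i : Δ => L (e i)) := by
    rw [linearIndependent_iff]
    intro l hl
    have hl' : L (Finsupp.linearCombination K (fun i : Δ => e i) l) = 0 := by
      rw [Finsupp.apply_linearCombination]; exact hl
    by_contra hne
    have hv : Finsupp.linearCombination K (fun i : Δ => e i) l ≠ 0 := by
      intro h0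
      refine hne (Finsupp.ext fun j => ?_)
      rw [← hcoef l j, h0]; simp
    obtain ⟨i, hi⟩ := exists_isLeadIndex (rk := rk) hinj hfin hv
    by_cases hiΔ : i ∈ Δ
    · exact hiΔ.2 ⟨_, hl', hi⟩
    · exact hi.1.2 (hcoef' l i hi.1.1 hiΔ)
  -- Division with remainder: the top term of `v` is cancelled by `e i` when `i ∈ Δ`, and otherwise
  -- by a kernel element with leading index `i`. Since `rk` is injective, one cancellation clears
  -- the whole rank `N`.
  have key : ∀ N : ℕ, ∀ v : V, (∀ i ∈ M, c v i ≠ 0 → rk i < N) →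
      L v ∈ Submodule.span K (Set.range fun i : Δ => L (e i)) := by
    intro N
    induction N with
    | zero =>
      intro v hv
      have : v = 0 := hinj v fun i hi => by
        by_contra h; exact absurd (hv i hi h) (by simp)
      simp [this]
    | succ N ih =>
      intro v hv
      by_cases hex : ∃ i ∈ M, c v i ≠ 0 ∧ rk i = N
      · obtain ⟨i, hiM, hi, hiN⟩ := hex
        obtain ⟨g, hg1, hg2, hg3⟩ : ∃ g : V,
            L g ∈ Submodule.span K (Set.range fun i : Δ => L (e i)) ∧ c g i ≠ 0 ∧
            ∀ j ∈ M, c g j ≠ 0 → rk j ≤ N := by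
          by_cases hiΔ : i ∈ Δ
          · refine ⟨e i, Submodule.subset_span ⟨⟨i, hiΔ⟩, rfl⟩, by simp [he i hiM i hiM], ?_⟩
            intro j hj hne
            by_cases hji : j = i
            · rw [hji, hiN]
            · simp [he i hiM j hj, hji] at hne
          · have : ∃ v, L v = 0 ∧ IsLeadIndex M c rk v i := by
              by_contra h; exact hiΔ ⟨hiM, h⟩
            obtain ⟨g, hg, hgi⟩ := this
            refine ⟨g, by simp [hg], hgi.1.2, fun j hj hne => ?_⟩
            rw [← hiN]; exact hgi.2 j ⟨hj, hne⟩
        have h1 := ih (v - (c v i / c g i) • g) (by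
          intro j hj hne
          have hle : rk j ≤ N := by
            by_cases hvj : c v j = 0
            · refine hg3 j hj fun h0 => hne ?_
              simp [hvj, h0]
            · exact Nat.lt_succ_iff.1 (hv j hj hvj)
          refine lt_of_le_of_ne hle fun h => hne ?_
          have : j = i := hrk (h.trans hiN.symm)
          subst this
          simp [div_mul_cancel₀ _ hg2])
        have h2 : L v = L (v - (c v i / c g i) • g) + (c v i / c g i) • L g := by simp
        rw [h2]
        exact Submodule.add_mem _ h1 (Submodule.smul_mem _ _ hg1)
      · refine ih v fun i hi hne => ?_
        refine lt_of_le_of_ne (Nat.lt_succ_iff.1 (hv i hi hne)) fun h => hex ⟨i, hi, hne, h⟩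
  have hspan : ⊤ ≤ Submodule.span K (Set.range fun i : Δ => L (e i)) := by
    intro w _
    obtain ⟨v, rfl⟩ := hL w
    obtain ⟨N, hN⟩ := ((hfin v).image rk).bddAbove
    exact key (N + 1) v fun i hi hne => Nat.lt_succ_iff.2 (hN ⟨i, ⟨hi, hne⟩, rfl⟩)
  let b := Module.Basis.mk hli hspan
  have hf : Finite Δ := Module.Finite.finite_basis b
  refine ⟨Set.toFinite Δ, ?_⟩
  rw [Module.finrank_eq_nat_card_basis b]
  rfl

end Leading
end

/-! ### The coordinate ring: monomial basis, weight filtration, additivity of the pole order -/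

noncomputable section
namespace MiuraKamiyaCurve

variable {F : Type*} [Field F] (X : MiuraKamiyaCurve F)

/-! ### Nongaps and exponents -/

theorem mem_S (i j : ℕ) : X.a * i + X.b * j ∈ X.S := ⟨i, j, rfl⟩

theorem zero_mem_S : 0 ∈ X.S := ⟨0, 0, by simp⟩

theorem add_mem_S {s t : ℕ} (hs : s ∈ X.S) (ht : t ∈ X.S) : s + t ∈ X.S := by
  obtain ⟨i, j, rfl⟩ := hs
  obtain ⟨k, l, rfl⟩ := ht
  exact ⟨i + k, j + l, by ring⟩

theorem expY_lt (s : ℕ) : X.expY s < X.a := by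
  have : NeZero X.a := ⟨X.a_pos.ne'⟩
  exact ZMod.val_lt _

/-- Modulo `a` the weight is `b j`, and coprimality makes `b` invertible. -/
theorem expY_eq (i : ℕ) {j : ℕ} (hj : j < X.a) : X.expY (X.a * i + X.b * j) = j := by
  have : NeZero X.a := ⟨X.a_pos.ne'⟩
  have h : ((X.b : ZMod X.a)⁻¹ * (X.b : ZMod X.a)) = 1 := by
    rw [mul_comm]; exact ZMod.coe_mul_inv_eq_one _ X.coprime.symm
  unfold expY
  push_cast
  rw [ZMod.natCast_self, zero_mul, zero_add, ← mul_assoc, h, one_mul, ZMod.val_natCast,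
    Nat.mod_eq_of_lt hj]

theorem expX_eq (i : ℕ) {j : ℕ} (hj : j < X.a) : X.expX (X.a * i + X.b * j) = i := by
  rw [expX, X.expY_eq i hj, Nat.add_sub_cancel, Nat.mul_div_cancel_left _ X.a_pos]

theorem exists_reduced {s : ℕ} (hs : s ∈ X.S) : ∃ i j, j < X.a ∧ s = X.a * i + X.b * j := by
  obtain ⟨i, j, rfl⟩ := hs
  refine ⟨i + X.b * (j / X.a), j % X.a, Nat.mod_lt _ X.a_pos, ?_⟩
  conv_lhs => rw [← Nat.div_add_mod j X.a]
  ring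

theorem exp_spec {s : ℕ} (hs : s ∈ X.S) : X.a * X.expX s + X.b * X.expY s = s := by
  obtain ⟨i, j, hj, rfl⟩ := X.exists_reduced hs
  rw [X.expX_eq i hj, X.expY_eq i hj]

theorem phi_eq (i : ℕ) {j : ℕ} (hj : j < X.a) :
    X.phi (X.a * i + X.b * j) = X.x ^ i * X.y ^ j := by
  rw [phi, X.expX_eq i hj, X.expY_eq i hj]

/-! ### Coefficients -/

theorem const_mul (c : F) (f : X.R) : X.const c * f = c • f := by
  rw [Algebra.smul_def]; rfl

theorem normalForm_add (f g : X.R) :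
    X.normalForm (f + g) = X.normalForm f + X.normalForm g := map_add _ _ _

theorem normalForm_smul (c : F) (f : X.R) :
    X.normalForm (c • f) = Polynomial.C (Polynomial.C c) * X.normalForm f := by
  have h : c • f = (Polynomial.C c : F[X]) • f := by
    rw [Algebra.smul_def, Algebra.smul_def]; rfl
  rw [h, normalForm, map_smul, smul_eq_C_mul]; rfl

/-- All coefficients of an element of `R`, as a linear map. -/
def coeffHom : X.R →ₗ[F] ℕ → F where
  toFun f s := X.coeff f s
  map_add' f g := by funext s; simp [coeff, normalForm_add]
  map_smul' c f := by funext s; simp [coeff, normalForm_smul]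

@[simp] theorem coeffHom_apply (f : X.R) (s : ℕ) : X.coeffHom f s = X.coeff f s := rfl

theorem coeff_add (f g : X.R) (s : ℕ) : X.coeff (f + g) s = X.coeff f s + X.coeff g s :=
  congrFun (map_add X.coeffHom f g) s

theorem coeff_sub (f g : X.R) (s : ℕ) : X.coeff (f - g) s = X.coeff f s - X.coeff g s :=
  congrFun (map_sub X.coeffHom f g) s

theorem coeff_smul (c : F) (f : X.R) (s : ℕ) : X.coeff (c • f) s = c * X.coeff f s :=
  congrFun (map_smul X.coeffHom c f) s

theorem coeff_zero (s : ℕ) : X.coeff 0 s = 0 := congrFun (map_zero X.coeffHom) s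

theorem poly_degree : X.poly.degree = X.a := by
  rw [poly, degree_add_eq_left_of_degree_lt, degree_X_pow]
  rw [degree_X_pow]
  exact X.tail_degree_lt

theorem normalForm_degree_lt (f : X.R) : (X.normalForm f).degree < X.a := by
  induction f using AdjoinRoot.induction_on with
  | ih p =>
    rw [normalForm, AdjoinRoot.modByMonicHom_mk, ← X.poly_degree]
    exact degree_modByMonic_lt _ X.monic_poly

theorem mk_normalForm (f : X.R) : AdjoinRoot.mk X.poly (X.normalForm f) = f :=
  AdjoinRoot.mk_leftInverse X.monic_poly f

theorem normalForm_coeff (f : X.R) (i : ℕ) {j : ℕ} (hj : j < X.a) :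
    ((X.normalForm f).coeff j).coeff i = X.coeff f (X.a * i + X.b * j) := by
  rw [coeff, X.expX_eq i hj, X.expY_eq i hj]

theorem lt_of_normalForm_coeff_ne_zero {f : X.R} {j : ℕ} (h : (X.normalForm f).coeff j ≠ 0) :
    j < X.a := by
  by_contra hj
  refine h (coeff_eq_zero_of_degree_lt (lt_of_lt_of_le (X.normalForm_degree_lt f) ?_))
  exact_mod_cast not_lt.1 hj

theorem eq_zero_of_coeff {f : X.R} (h : ∀ s ∈ X.S, X.coeff f s = 0) : f = 0 := by
  rw [← X.mk_normalForm f]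
  have : X.normalForm f = 0 := by
    ext j i
    by_cases hj : j < X.a
    · rw [X.normalForm_coeff f i hj, h _ (X.mem_S i j)]; simp
    · have : (X.normalForm f).coeff j = 0 := by
        by_contra h0; exact hj (X.lt_of_normalForm_coeff_ne_zero h0)
      simp [this]
  rw [this, map_zero]

theorem x_pow_mul_y_pow (i j : ℕ) : X.x ^ i * X.y ^ j =
    AdjoinRoot.mk X.poly (Polynomial.C (Polynomial.X ^ i) * Polynomial.X ^ j) := by
  simp [x, y, AdjoinRoot.mk_C, AdjoinRoot.mk_X]

theorem coeff_phi {s t : ℕ} (hs : s ∈ X.S) (ht : t ∈ X.S) :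
    X.coeff (X.phi s) t = if t = s then 1 else 0 := by
  have hn : X.normalForm (X.phi s) =
      Polynomial.C (Polynomial.X ^ X.expX s) * Polynomial.X ^ X.expY s := by
    rw [phi, X.x_pow_mul_y_pow, normalForm, AdjoinRoot.modByMonicHom_mk,
      modByMonic_eq_self_iff X.monic_poly, X.poly_degree]
    refine lt_of_le_of_lt (degree_C_mul_X_pow_le _ _) ?_
    exact_mod_cast X.expY_lt s
  rw [coeff, hn, coeff_C_mul_X_pow]
  by_cases hts : t = s
  · simp [hts]
  · rw [if_neg hts]
    by_cases hY : X.expY t = X.expY s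
    · rw [if_pos hY, coeff_X_pow, if_neg]
      intro hX
      exact hts (by rw [← X.exp_spec hs, ← X.exp_spec ht, hX, hY])
    · rw [if_neg hY]; simp

theorem finite_support (f : X.R) : {s | s ∈ X.S ∧ X.coeff f s ≠ 0}.Finite := by
  refine ((X.normalForm f).support.biUnion fun j =>
    ((X.normalForm f).coeff j).support.image fun i => X.a * i + X.b * j).finite_toSet.subset ?_
  rintro s ⟨hs, h⟩
  simp only [Finset.coe_biUnion, Set.mem_iUnion, Finset.mem_coe, mem_support_iff,
    Finset.mem_image]
  refine ⟨X.expY s, ?_, X.expX s, h, X.exp_spec hs⟩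
  intro h0
  exact h (by rw [coeff, h0]; simp)

/-- The functions all of whose monomials `φ_t` satisfy `t < N`. -/
def low (N : ℤ) : Submodule F X.R where
  carrier := {f | ∀ t ∈ X.S, X.coeff f t ≠ 0 → (t : ℤ) < N}
  add_mem' {f g} hf hg t ht h := by
    by_cases h0 : X.coeff f t = 0
    · exact hg t ht fun h1 => h (by rw [coeff_add, h0, h1, add_zero])
    · exact hf t ht h0
  zero_mem' t _ h := absurd (X.coeff_zero t) h
  smul_mem' c f hf t ht h := hf t ht fun h0 => h (by rw [coeff_smul, h0, mul_zero])

variable {X}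

theorem low_mono {N M : ℤ} (h : N ≤ M) : X.low N ≤ X.low M :=
  fun _ hf t ht h0 => (hf t ht h0).trans_le h

theorem coeff_eq_zero_of_mem_low {N : ℤ} {f : X.R} (hf : f ∈ X.low N) {t : ℕ} (ht : t ∈ X.S)
    (h : N ≤ t) : X.coeff f t = 0 := by
  by_contra h0
  exact absurd (hf t ht h0) (not_lt.2 h)

theorem phi_mem_low {s : ℕ} (hs : s ∈ X.S) {N : ℤ} (h : (s : ℤ) < N) : X.phi s ∈ X.low N := by
  intro t ht h0
  rw [X.coeff_phi hs ht] at h0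
  by_cases hts : t = s
  · rwa [hts]
  · simp [hts] at h0

/-- Lets bounds on products, and values at points, be checked on monomials alone. -/
theorem low_eq_span (N : ℤ) :
    X.low N = Submodule.span F {f | ∃ t ∈ X.S, (t : ℤ) < N ∧ f = X.phi t} := by
  apply le_antisymm
  · intro f hf
    have hfs : f = ∑ s ∈ (X.finite_support f).toFinset, X.coeff f s • X.phi s := by
      rw [← sub_eq_zero]
      refine X.eq_zero_of_coeff fun t ht => ?_
      rw [coeff_sub, ← X.coeffHom_apply (Finset.sum _ _), map_sum, Finset.sum_apply, sub_eq_zero]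
      simp only [coeffHom_apply, coeff_smul]
      rw [Finset.sum_eq_single t]
      · simp [X.coeff_phi ht ht]
      · intro s hs hst
        have hs : s ∈ X.S ∧ X.coeff f s ≠ 0 := by simpa using hs
        simp [X.coeff_phi hs.1 ht, Ne.symm hst]
      · intro h
        have : X.coeff f t = 0 := by
          by_contra h0
          exact h (by simpa using ⟨ht, h0⟩)
        simp [this]
    rw [hfs]
    refine Submodule.sum_mem _ fun s hs => Submodule.smul_mem _ _ (Submodule.subset_span ?_)
    have hs : s ∈ X.S ∧ X.coeff f s ≠ 0 := by simpa using hs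
    exact ⟨s, hs.1, hf s hs.1 hs.2, rfl⟩
  · rw [Submodule.span_le]
    rintro _ ⟨t, ht, h, rfl⟩
    exact phi_mem_low ht h

theorem exists_mem_low (f : X.R) : ∃ N : ℤ, f ∈ X.low N := by
  obtain ⟨N, hN⟩ := (X.finite_support f).bddAbove
  refine ⟨N + 1, fun t ht h => ?_⟩
  have := hN ⟨ht, h⟩
  omega

/-! ### Products of monomials -/

variable (X) in
theorem y_pow_a : X.y ^ X.a = - AdjoinRoot.mk X.poly X.tail := by
  have h : AdjoinRoot.mk X.poly X.poly = 0 := AdjoinRoot.mk_self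
  rw [poly, map_add, map_pow, AdjoinRoot.mk_X] at h
  exact eq_neg_of_add_eq_zero_left h

variable (X) in
theorem mk_tail : AdjoinRoot.mk X.poly X.tail =
    (∑ j ∈ Finset.range X.a, ∑ i ∈ Finset.range X.b,
      if X.a * i + X.b * j < X.a * X.b then X.c i j • (X.x ^ i * X.y ^ j) else 0) +
    X.d • X.x ^ X.b := by
  rw [tail, map_add, map_sum]
  congr 1
  · refine Finset.sum_congr rfl fun j _ => ?_
    rw [map_sum]
    refine Finset.sum_congr rfl fun i _ => ?_
    split_ifs
    · rw [← const_mul, x_pow_mul_y_pow, const, ← AdjoinRoot.mk_C, ← map_mul, C_mul, mul_assoc]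
    · simp
  · rw [← const_mul, const, x, AdjoinRoot.mk_C, map_mul, map_pow]

-- Replacing `y ^ a` by the other terms of the equation keeps the weight only in the term `d x ^ b`;
-- all others drop below `ab`. As `d ≠ 0`, the leading coefficient survives. The outer induction, on
-- the weight, disposes of the lower terms; the inner one, on `j`, follows the term of full weight.
variable (X) in
theorem x_pow_mul_y_pow_sub_mem_low (i j : ℕ) : ∃ c : F, c ≠ 0 ∧
    X.x ^ i * X.y ^ j - c • X.phi (X.a * i + X.b * j) ∈ X.low ((X.a * i + X.b * j : ℕ)) := by
  obtain ⟨N, hN⟩ : ∃ N, N = X.a * i + X.b * j := ⟨_, rfl⟩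
  induction N using Nat.strong_induction_on generalizing i j with
  | _ N ihN =>
  have hlow : ∀ i' j', X.a * i' + X.b * j' < N → X.x ^ i' * X.y ^ j' ∈ X.low N := by
    intro i' j' h
    obtain ⟨c, -, hc⟩ := ihN _ h i' j' rfl
    rw [← sub_add_cancel (X.x ^ i' * X.y ^ j') (c • X.phi (X.a * i' + X.b * j'))]
    refine Submodule.add_mem _ (low_mono (by exact_mod_cast h.le) hc)
      (Submodule.smul_mem _ _ (phi_mem_low (X.mem_S _ _) (by exact_mod_cast h)))
  rw [← hN]
  induction j using Nat.strong_induction_on generalizing i with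
  | _ j ihj =>
  by_cases hj : j < X.a
  · refine ⟨1, one_ne_zero, ?_⟩
    rw [hN, X.phi_eq i hj, one_smul, sub_self]
    exact Submodule.zero_mem _
  · obtain ⟨k, rfl⟩ := Nat.exists_eq_add_of_le (not_lt.1 hj)
    have hN' : N = X.a * (i + X.b) + X.b * k := by rw [hN]; ring
    obtain ⟨c, hc, hm⟩ := ihj k (by have := X.a_pos; omega) (i + X.b) hN'
    refine ⟨-X.d * c, mul_ne_zero (neg_ne_zero.2 X.d_ne_zero) hc, ?_⟩
    have hexp : X.x ^ i * X.y ^ (X.a + k) - (-X.d * c) • X.phi N =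
        - (∑ j ∈ Finset.range X.a, ∑ i' ∈ Finset.range X.b,
          if X.a * i' + X.b * j < X.a * X.b then
            X.c i' j • (X.x ^ (i + i') * X.y ^ (k + j)) else 0) +
        (-X.d) • (X.x ^ (i + X.b) * X.y ^ k - c • X.phi N) := by
      have e1 : X.x ^ i * X.y ^ (X.a + k) = (X.x ^ i * X.y ^ k) * X.y ^ X.a := by ring
      rw [e1, y_pow_a, mk_tail, smul_sub, smul_smul, neg_add, mul_add, mul_neg, mul_neg,
        mul_smul_comm, Finset.mul_sum, neg_smul, ← add_sub_assoc]
      congr 3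
      · refine Finset.sum_congr rfl fun j _ => ?_
        rw [Finset.mul_sum]
        refine Finset.sum_congr rfl fun i' _ => ?_
        split_ifs
        · rw [mul_smul_comm]; congr 1; ring
        · simp
      · congr 1; ring
    rw [hexp]
    refine Submodule.add_mem _ (Submodule.neg_mem _ ?_) (Submodule.smul_mem _ _ hm)
    refine Submodule.sum_mem _ fun j _ => Submodule.sum_mem _ fun i' _ => ?_
    split_ifs with hlt
    · refine Submodule.smul_mem _ _ (hlow _ _ ?_)
      rw [hN]
      nlinarith
    · exact Submodule.zero_mem _

theorem phi_mul_phi {s t : ℕ} (hs : s ∈ X.S) (ht : t ∈ X.S) : ∃ c : F, c ≠ 0 ∧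
    X.phi s * X.phi t - c • X.phi (s + t) ∈ X.low ((s + t : ℕ)) := by
  obtain ⟨c, hc, h⟩ := X.x_pow_mul_y_pow_sub_mem_low (X.expX s + X.expX t) (X.expY s + X.expY t)
  have e : X.a * (X.expX s + X.expX t) + X.b * (X.expY s + X.expY t) = s + t := by
    conv_rhs => rw [← X.exp_spec hs, ← X.exp_spec ht]
    ring
  rw [e] at h
  refine ⟨c, hc, ?_⟩
  convert h using 2
  rw [phi, phi]; ring

theorem phi_mul_phi_mem_low {s t : ℕ} (hs : s ∈ X.S) (ht : t ∈ X.S) :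
    X.phi s * X.phi t ∈ X.low (s + t + 1) := by
  obtain ⟨c, -, h⟩ := phi_mul_phi hs ht
  rw [← sub_add_cancel (X.phi s * X.phi t) (c • X.phi (s + t))]
  refine Submodule.add_mem _ (low_mono (by push_cast; omega) h)
    (Submodule.smul_mem _ _ (phi_mem_low (X.add_mem_S hs ht) (by push_cast; omega)))

/-- The `-1` comes from the strict bounds: weights at most `N - 1` and `M - 1` add up to at most `N
+ M - 2`. -/
theorem mul_mem_low {N M : ℤ} {f g : X.R} (hf : f ∈ X.low N) (hg : g ∈ X.low M) :
    f * g ∈ X.low (N + M - 1) := by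
  rw [low_eq_span N] at hf
  rw [low_eq_span M] at hg
  induction hf using Submodule.span_induction with
  | mem f hf =>
    obtain ⟨s, hs, hsN, rfl⟩ := hf
    induction hg using Submodule.span_induction with
    | mem g hg =>
      obtain ⟨t, ht, htM, rfl⟩ := hg
      exact low_mono (by omega) (phi_mul_phi_mem_low hs ht)
    | zero => simp
    | add g g' _ _ h h' => rw [mul_add]; exact Submodule.add_mem _ h h'
    | smul c g _ h => rw [mul_smul_comm]; exact Submodule.smul_mem _ _ h
  | zero => simp
  | add f f' _ _ h h' => rw [add_mul]; exact Submodule.add_mem _ h h'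
  | smul c f _ h => rw [smul_mul_assoc]; exact Submodule.smul_mem _ _ h

/-! ### Leading monomials in `R` -/

variable (X) in
/-- `φ_t` is the leading monomial of `f`. -/
def HasLead (f : X.R) (t : ℕ) : Prop := t ∈ X.S ∧ X.coeff f t ≠ 0 ∧ f ∈ X.low (t + 1)

theorem HasLead.ne_zero {f : X.R} {t : ℕ} (h : X.HasLead f t) : f ≠ 0 := by
  rintro rfl
  exact h.2.1 (X.coeff_zero t)

theorem hasLead_delta {f : X.R} (hf : f ≠ 0) : X.HasLead f (X.delta f) := by
  have hle : f ∈ X.low (X.delta f + 1) := by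
    intro t ht h
    have h1 : X.a * X.expX t + X.b * X.expY t ≤ X.delta f := by
      have hj : X.expY t ∈ (X.normalForm f).support := by
        rw [mem_support_iff]; intro h0; exact h (by rw [coeff, h0]; simp)
      refine le_trans ?_ (Finset.le_sup (f := fun j => ((X.normalForm f).coeff j).support.sup
        fun i => X.a * i + X.b * j) hj)
      exact Finset.le_sup (f := fun i => X.a * i + X.b * X.expY t) (mem_support_iff.2 h)
    rw [X.exp_spec ht] at h1
    omega
  have hne : (X.normalForm f).support.Nonempty := by
    rw [Finset.nonempty_iff_ne_empty, Ne, support_eq_empty]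
    intro h
    exact hf (by rw [← X.mk_normalForm f, h, map_zero])
  obtain ⟨j, hj, hjs⟩ := Finset.exists_mem_eq_sup _ hne (fun j =>
    ((X.normalForm f).coeff j).support.sup fun i => X.a * i + X.b * j)
  have hj0 := mem_support_iff.1 hj
  have hne' : ((X.normalForm f).coeff j).support.Nonempty := by
    rw [Finset.nonempty_iff_ne_empty, Ne, support_eq_empty]
    exact hj0
  obtain ⟨i, hi, his⟩ := Finset.exists_mem_eq_sup _ hne' (fun i => X.a * i + X.b * j)
  have hd : X.delta f = X.a * i + X.b * j := by rw [delta, hjs, his]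
  refine ⟨hd ▸ X.mem_S i j, ?_, hle⟩
  rw [hd, ← X.normalForm_coeff f i (X.lt_of_normalForm_coeff_ne_zero hj0)]
  exact mem_support_iff.1 hi

theorem HasLead.unique {f : X.R} {s t : ℕ} (hs : X.HasLead f s) (ht : X.HasLead f t) :
    s = t := by
  have h1 := hs.2.2 t ht.1 ht.2.1
  have h2 := ht.2.2 s hs.1 hs.2.1
  omega

theorem HasLead.delta_eq {f : X.R} {t : ℕ} (h : X.HasLead f t) : X.delta f = t :=
  (hasLead_delta h.ne_zero).unique h

theorem hasLead_phi {s : ℕ} (hs : s ∈ X.S) : X.HasLead (X.phi s) s :=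
  ⟨hs, by simp [X.coeff_phi hs hs], phi_mem_low hs (by omega)⟩

theorem HasLead.smul {f : X.R} {t : ℕ} (h : X.HasLead f t) {c : F} (hc : c ≠ 0) :
    X.HasLead (c • f) t :=
  ⟨h.1, by rw [coeff_smul]; exact mul_ne_zero hc h.2.1, Submodule.smul_mem _ _ h.2.2⟩

theorem HasLead.add_low {f g : X.R} {t : ℕ} (h : X.HasLead f t) (hg : g ∈ X.low t) :
    X.HasLead (f + g) t :=
  ⟨h.1, by rw [coeff_add, coeff_eq_zero_of_mem_low hg h.1 le_rfl, add_zero]; exact h.2.1,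
    Submodule.add_mem _ h.2.2 (low_mono (by omega) hg)⟩

theorem HasLead.sub_low {f g : X.R} {t : ℕ} (h : X.HasLead f t) (hg : g ∈ X.low t) :
    X.HasLead (f - g) t := by
  rw [sub_eq_add_neg]; exact h.add_low (Submodule.neg_mem _ hg)

theorem mem_low_of_coeff_eq_zero {f : X.R} {t : ℕ} (hf : f ∈ X.low (t + 1))
    (h : t ∈ X.S → X.coeff f t = 0) : f ∈ X.low t := by
  intro r hr h0
  have := hf r hr h0
  by_contra hlt
  have : r = t := by omega
  subst this
  exact h0 (h hr)

theorem HasLead.sub_mem_low {f : X.R} {t : ℕ} (h : X.HasLead f t) :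
    f - X.coeff f t • X.phi t ∈ X.low t := by
  refine mem_low_of_coeff_eq_zero (Submodule.sub_mem _ h.2.2
    (Submodule.smul_mem _ _ (hasLead_phi h.1).2.2)) fun _ => ?_
  rw [coeff_sub, coeff_smul, X.coeff_phi h.1 h.1, if_pos rfl, mul_one, sub_self]

/-- With each factor split into leading term and remainder, only the product of the leading terms
reaches weight `s + t`, and `phi_mul_phi` says that it does. -/
theorem HasLead.mul {f g : X.R} {s t : ℕ} (hf : X.HasLead f s) (hg : X.HasLead g t) :
    X.HasLead (f * g) (s + t) := by
  obtain ⟨c, hc, h⟩ := phi_mul_phi hf.1 hg.1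
  have e : f * g = (X.coeff f s * X.coeff g t * c) • X.phi (s + t) +
      ((X.coeff f s * X.coeff g t) • (X.phi s * X.phi t - c • X.phi (s + t)) +
        (f - X.coeff f s • X.phi s) * g +
        (X.coeff f s • X.phi s) * (g - X.coeff g t • X.phi t)) := by
    simp only [smul_sub, sub_mul, mul_sub, smul_smul, smul_mul_assoc, mul_smul_comm,
      mul_comm (X.coeff g t)]
    abel
  rw [e]
  refine ((hasLead_phi (X.add_mem_S hf.1 hg.1)).smul
    (mul_ne_zero (mul_ne_zero hf.2.1 hg.2.1) hc)).add_low ?_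
  refine Submodule.add_mem _ (Submodule.add_mem _ (Submodule.smul_mem _ _ h) ?_) ?_
  · exact low_mono (by push_cast; omega) (mul_mem_low hf.sub_mem_low hg.2.2)
  · exact low_mono (by push_cast; omega)
      (mul_mem_low (Submodule.smul_mem _ _ (hasLead_phi hf.1).2.2) hg.sub_mem_low)

theorem dvd_left_mem {s t : ℕ} (hs : s ∈ X.S) (h : X.Dvd s t) : t ∈ X.S := by
  obtain ⟨r, hr, rfl⟩ := h
  exact X.add_mem_S hs hr

theorem Dvd.refl (s : ℕ) : X.Dvd s s := ⟨0, X.zero_mem_S, rfl⟩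

theorem Dvd.trans {s t r : ℕ} (h : X.Dvd s t) (h' : X.Dvd t r) : X.Dvd s r := by
  obtain ⟨p, hp, rfl⟩ := h
  obtain ⟨q, hq, rfl⟩ := h'
  exact ⟨p + q, X.add_mem_S hp hq, by ring⟩

theorem Dvd.le {s t : ℕ} (h : X.Dvd s t) : s ≤ t := by
  obtain ⟨p, _, rfl⟩ := h; omega

end MiuraKamiyaCurve
end

/-! ### Values at points, sizes of the sets `Δ`, and the weight bound for codewords -/

noncomputable section
namespace MiuraKamiyaCurve

variable {F : Type*} [Field F] {X : MiuraKamiyaCurve F}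

/-! ### Evaluation at points -/

theorem evalAt_add (p : X.Point) (f g : X.R) :
    X.evalAt p (f + g) = X.evalAt p f + X.evalAt p g := map_add _ _ _

theorem evalAt_sub (p : X.Point) (f g : X.R) :
    X.evalAt p (f - g) = X.evalAt p f - X.evalAt p g := map_sub _ _ _

theorem evalAt_neg (p : X.Point) (f : X.R) : X.evalAt p (-f) = -X.evalAt p f := map_neg _ _

theorem evalAt_mul (p : X.Point) (f g : X.R) :
    X.evalAt p (f * g) = X.evalAt p f * X.evalAt p g := map_mul _ _ _

theorem evalAt_zero (p : X.Point) : X.evalAt p 0 = 0 := map_zero _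

theorem evalAt_one (p : X.Point) : X.evalAt p 1 = 1 := map_one _

theorem evalAt_const (p : X.Point) (c : F) : X.evalAt p (X.const c) = c := by
  rw [evalAt, const, ← AdjoinRoot.mk_C, AdjoinRoot.evalEval_mk]
  simp [evalEval]

theorem evalAt_x (p : X.Point) : X.evalAt p X.x = p.1.1 := by
  rw [evalAt, x, ← AdjoinRoot.mk_C, AdjoinRoot.evalEval_mk]
  simp [evalEval]

theorem evalAt_y (p : X.Point) : X.evalAt p X.y = p.1.2 := by
  rw [evalAt, y, ← AdjoinRoot.mk_X, AdjoinRoot.evalEval_mk]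
  simp [evalEval]

theorem evalAt_smul (p : X.Point) (c : F) (f : X.R) :
    X.evalAt p (c • f) = c * X.evalAt p f := by
  rw [← const_mul, evalAt_mul, evalAt_const]

theorem mem_maxIdeal (p : X.Point) (f : X.R) : f ∈ X.maxIdeal p ↔ X.evalAt p f = 0 := by
  constructor
  · intro h
    have hle : X.maxIdeal p ≤ RingHom.ker (AdjoinRoot.evalEval p.2) := by
      rw [maxIdeal, Ideal.span_le]
      rintro g (rfl | rfl)
      · change X.evalAt p _ = 0
        rw [evalAt_sub, evalAt_x, evalAt_const, sub_self]
      · change X.evalAt p _ = 0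
        rw [evalAt_sub, evalAt_y, evalAt_const, sub_self]
    exact hle h
  · intro h
    -- Modulo the ideal `x` and `y` become the coordinates of `p`, so each monomial, and by
    -- linearity each function, is congruent to its value.
    have key : Ideal.Quotient.mk (X.maxIdeal p) f =
        Ideal.Quotient.mk (X.maxIdeal p) (X.const (X.evalAt p f)) := by
      have hx : Ideal.Quotient.mk (X.maxIdeal p) X.x =
          Ideal.Quotient.mk (X.maxIdeal p) (X.const p.1.1) :=
        Ideal.Quotient.eq.2 (Ideal.subset_span (by simp))
      have hy : Ideal.Quotient.mk (X.maxIdeal p) X.y =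
          Ideal.Quotient.mk (X.maxIdeal p) (X.const p.1.2) :=
        Ideal.Quotient.eq.2 (Ideal.subset_span (by simp))
      have hc : ∀ a b, X.const (a + b) = X.const a + X.const b := by simp [const]
      have hm : ∀ a b, X.const (a * b) = X.const a * X.const b := by simp [const]
      have hp : ∀ a (k : ℕ), X.const (a ^ k) = X.const a ^ k := by simp [const]
      obtain ⟨N, hN⟩ := exists_mem_low f
      rw [low_eq_span] at hN
      -- The vanishing of `f` does not pass to its monomials, so it must leave the induction.
      clear h
      induction hN using Submodule.span_induction with
      | mem g hg =>
        obtain ⟨t, -, -, rfl⟩ := hg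
        have : X.evalAt p (X.phi t) = p.1.1 ^ X.expX t * p.1.2 ^ X.expY t := by
          rw [← evalAt_x, ← evalAt_y]
          simp [phi, evalAt]
        rw [this, hm, hp, hp, phi, map_mul, map_pow, map_pow, hx, hy, map_mul, map_pow, map_pow]
      | zero => rw [evalAt_zero]; simp [const]
      | add g g' _ _ h h' => rw [evalAt_add, hc, map_add, map_add, h, h']
      | smul c g _ h => rw [evalAt_smul, hm, map_mul, ← const_mul, map_mul, h]
    rw [h] at key
    rw [← Ideal.Quotient.eq_zero_iff_mem, key]
    simp [const]

variable {n : ℕ} (P : Fin n ↪ X.Point)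

/-- Lagrange interpolation: distinct points differ in `x` or in `y`, so a linear function separates
each pair, and the product over `j ≠ i` does the rest. -/
theorem exists_evalAt_eq_one (i : Fin n) :
    ∃ f, X.evalAt (P i) f = 1 ∧ ∀ j ≠ i, X.evalAt (P j) f = 0 := by
  classical
  have h : ∀ j, j ≠ i → ∃ g, X.evalAt (P i) g = 1 ∧ X.evalAt (P j) g = 0 := by
    intro j hj
    have hP : (P i).1 ≠ (P j).1 := fun h => hj (P.injective (Subtype.ext h)).symm
    by_cases h1 : (P i).1.1 = (P j).1.1
    · have h2 : (P i).1.2 - (P j).1.2 ≠ 0 := sub_ne_zero.2 fun h2 => hP (Prod.ext h1 h2)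
      refine ⟨((P i).1.2 - (P j).1.2)⁻¹ • (X.y - X.const (P j).1.2), ?_, ?_⟩
      · rw [evalAt_smul, evalAt_sub, evalAt_y, evalAt_const, inv_mul_cancel₀ h2]
      · rw [evalAt_smul, evalAt_sub, evalAt_y, evalAt_const, sub_self, mul_zero]
    · have h2 : (P i).1.1 - (P j).1.1 ≠ 0 := sub_ne_zero.2 h1
      refine ⟨((P i).1.1 - (P j).1.1)⁻¹ • (X.x - X.const (P j).1.1), ?_, ?_⟩
      · rw [evalAt_smul, evalAt_sub, evalAt_x, evalAt_const, inv_mul_cancel₀ h2]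
      · rw [evalAt_smul, evalAt_sub, evalAt_x, evalAt_const, sub_self, mul_zero]
  choose! g hg using h
  have hprod : ∀ p : X.Point, X.evalAt p (∏ j ∈ Finset.univ.erase i, g j) =
      ∏ j ∈ Finset.univ.erase i, X.evalAt p (g j) := fun p =>
    map_prod (AdjoinRoot.evalEval p.2) _ _
  refine ⟨∏ j ∈ Finset.univ.erase i, g j, ?_, fun j hj => ?_⟩
  · rw [hprod]
    exact Finset.prod_eq_one fun j hj => (hg j (Finset.ne_of_mem_erase hj)).1
  · rw [hprod]
    exact Finset.prod_eq_zero (Finset.mem_erase.2 ⟨hj, Finset.mem_univ j⟩) (hg j hj).2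

theorem exists_ev_eq (v : Fin n → F) : ∃ f, X.ev P f = v := by
  choose f hf using exists_evalAt_eq_one P
  refine ⟨∑ i, v i • f i, ?_⟩
  funext j
  have : X.ev P (∑ i, v i • f i) j = ∑ i, X.evalAt (P j) (v i • f i) :=
    map_sum (AdjoinRoot.evalEval (P j).2) _ _
  rw [this, Finset.sum_eq_single j]
  · rw [evalAt_smul, (hf j).1, mul_one]
  · intro i _ hij
    rw [evalAt_smul, (hf i).2 j hij.symm, mul_zero]
  · simp

/-- The ideal of the functions that vanish at the points `P i`, `i ∈ A`. -/
def vanishing (A : Finset (Fin n)) : Ideal X.R := ⨅ i ∈ A, X.maxIdeal (P i)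

variable {P}

theorem mem_vanishing {A : Finset (Fin n)} {f : X.R} :
    f ∈ vanishing P A ↔ ∀ i ∈ A, X.evalAt (P i) f = 0 := by
  simp [vanishing, Submodule.mem_iInf, mem_maxIdeal]

variable (P)

theorem J_eq_vanishing : X.J P = vanishing P Finset.univ := by
  simp [J, vanishing]

/-! ### The sets `Δ` of ideals -/

variable {P}

theorem mem_sigma {I : Ideal X.R} {t : ℕ} : t ∈ X.sigma I ↔ ∃ f ∈ I, X.HasLead f t := by
  constructor
  · rintro ⟨f, hf, h0, rfl⟩
    exact ⟨f, hf, hasLead_delta h0⟩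
  · rintro ⟨f, hf, h⟩
    exact ⟨f, hf, h.ne_zero, h.delta_eq⟩

theorem isLeadIndex_iff {f : X.R} {t : ℕ} :
    IsLeadIndex X.S X.coeffHom id f t ↔ X.HasLead f t := by
  constructor
  · rintro ⟨⟨h1, h2⟩, h3⟩
    refine ⟨h1, h2, fun r hr h => ?_⟩
    have : r ≤ t := h3 r ⟨hr, h⟩
    omega
  · rintro ⟨h1, h2, h3⟩
    refine ⟨⟨h1, h2⟩, fun r hr => ?_⟩
    have := h3 r hr.1 hr.2
    change r ≤ t
    omega

theorem Delta_antitone {I I' : Ideal X.R} (h : I ≤ I') : X.Delta I' ⊆ X.Delta I := by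
  rintro t ⟨ht, h'⟩
  exact ⟨ht, fun ⟨f, hf, h0⟩ => h' ⟨f, h hf, h0⟩⟩

variable (P)

/-- Evaluation at the points of `A` is onto by interpolation and has this ideal as kernel, so the
codimension count applies. -/
theorem Delta_vanishing (A : Finset (Fin n)) :
    (X.Delta (vanishing P A)).Finite ∧ (X.Delta (vanishing P A)).ncard = A.card := by
  let L : X.R →ₗ[F] (A → F) :=
    { toFun := fun f i => X.evalAt (P i) f
      map_add' := fun f g => by funext i; exact evalAt_add _ _ _
      map_smul' := fun c f => by funext i; exact evalAt_smul _ _ _ }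
  have hL : Function.Surjective L := by
    classical
    intro w
    obtain ⟨f, hf⟩ := exists_ev_eq P fun i => if h : i ∈ A then w ⟨i, h⟩ else 0
    refine ⟨f, funext fun i => ?_⟩
    have := congrFun hf i
    simp only [i.2, dif_pos] at this
    exact this
  have h := ncard_not_lead_ker (M := X.S) (c := X.coeffHom) (rk := id)
    (fun v hv => X.eq_zero_of_coeff hv) X.finite_support X.phi
    (fun i hi j hj => by
      rw [coeffHom_apply, X.coeff_phi hi hj]
      simp [Set.indicator_apply])
    Function.injective_id L hL
  have e : {i | i ∈ X.S ∧ ¬∃ v, L v = 0 ∧ IsLeadIndex X.S X.coeffHom id v i} =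
      X.Delta (vanishing P A) := by
    ext t
    simp only [Delta, Set.mem_ofPred_eq, Set.mem_sdiff, mem_sigma, isLeadIndex_iff, mem_vanishing]
    have : ∀ f, L f = 0 ↔ ∀ i ∈ A, X.evalAt (P i) f = 0 := by
      intro f
      rw [funext_iff]
      exact ⟨fun h i hi => h ⟨i, hi⟩, fun h i => h i i.2⟩
    simp only [this]
  rw [e] at h
  simpa using h

theorem Delta_J : (X.Delta (X.J P)).Finite ∧ (X.Delta (X.J P)).ncard = n := by
  have := Delta_vanishing P Finset.univ
  rwa [← J_eq_vanishing, Finset.card_univ, Fintype.card_fin] at this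

variable {P}

theorem mem_Delta_span_phi {s t : ℕ} (hs : s ∈ X.S) :
    t ∈ X.Delta (Ideal.span {X.phi s}) ↔ t ∈ X.S ∧ ¬ X.Dvd s t := by
  rw [Delta, Set.mem_sdiff, mem_sigma]
  refine and_congr_right fun ht => not_congr ⟨?_, ?_⟩
  · rintro ⟨f, hf, h⟩
    obtain ⟨g, rfl⟩ := Ideal.mem_span_singleton'.1 hf
    have hg : g ≠ 0 := by rintro rfl; exact h.ne_zero (zero_mul _)
    have h' := (hasLead_delta hg).mul (hasLead_phi hs)
    exact ⟨X.delta g, (hasLead_delta hg).1, by rw [h.unique h', add_comm]⟩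
  · rintro ⟨r, hr, rfl⟩
    exact ⟨X.phi s * X.phi r, Ideal.mul_mem_right _ _ (Ideal.mem_span_singleton_self _),
      (hasLead_phi hs).mul (hasLead_phi hr)⟩

theorem Delta_span_phi {s : ℕ} (hs : s ∈ X.S) :
    (X.Delta (Ideal.span {X.phi s})).Finite ∧ (X.Delta (Ideal.span {X.phi s})).ncard ≤ s := by
  rcases Nat.eq_zero_or_pos s with rfl | hpos
  · have : X.Delta (Ideal.span {X.phi 0}) = ∅ := by
      ext t
      rw [mem_Delta_span_phi hs]
      simp only [Set.mem_empty_iff_false, iff_false, not_and, not_not]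
      exact fun ht => ⟨t, ht, by omega⟩
    simp [this]
  have hmul : ∀ k, k * s ∈ X.S := by
    intro k
    induction k with
    | zero => simpa using X.zero_mem_S
    | succ k ih => rw [Nat.succ_mul]; exact X.add_mem_S ih hs
  have key : ∀ t ∈ X.S, ∀ t', ¬ X.Dvd s t' → t % s = t' % s → ¬ t < t' := by
    intro t ht t' ht' hmod hlt
    have h1 := Nat.div_add_mod t s
    have h2 := Nat.div_add_mod t' s
    rw [hmod] at h1
    have hdiv : t / s < t' / s := by
      by_contra hge
      have := Nat.mul_le_mul_left s (not_lt.1 hge)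
      omega
    obtain ⟨k, hk⟩ := Nat.exists_eq_add_of_lt hdiv
    refine ht' ⟨t + k * s, X.add_mem_S ht (hmul k), ?_⟩
    rw [hk] at h2
    have : s * (t / s + k + 1) = s * (t / s) + k * s + s := by ring
    omega
  have hinj : Set.InjOn (· % s) (X.Delta (Ideal.span {X.phi s})) := by
    intro t ht t' ht' h
    rw [mem_Delta_span_phi hs] at ht ht'
    have h1 := key t ht.1 t' ht'.2 h
    have h2 := key t' ht'.1 t ht.2 h.symm
    omega
  have hmaps : Set.MapsTo (· % s) (X.Delta (Ideal.span {X.phi s})) (Finset.range s) := by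
    intro t _
    simpa using Nat.mod_lt t hpos
  refine ⟨Set.Finite.of_injOn hmaps hinj (Finset.finite_toSet _), ?_⟩
  have := Set.ncard_le_ncard_of_injOn _ hmaps hinj (Finset.finite_toSet _)
  rwa [Set.ncard_coe_finset, Finset.card_range] at this

variable (P)

theorem sub_le_nu {s : ℕ} (hs : s ∈ X.S) : (n : ℤ) - s ≤ X.nu P s := by
  have h := Set.ncard_le_ncard (Set.subset_union_left (s := X.Delta (X.J P))
    (t := X.Delta (Ideal.span {X.phi s}))) ((Delta_J P).1.union (Delta_span_phi hs).1)
  rw [(Delta_J P).2] at h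
  rw [nu]
  omega

/-- Inclusion–exclusion, with `|Δ(J)| = n` and `|Δ(R φ_s)| ≤ s`. -/
theorem nu_add_ncard_inter_le {s : ℕ} (hs : s ∈ X.S) :
    X.nu P s + (X.Delta (X.J P) ∩ X.Delta (Ideal.span {X.phi s})).ncard ≤ n := by
  have h := Set.ncard_union_add_ncard_inter (X.Delta (X.J P)) (X.Delta (Ideal.span {X.phi s}))
    (Delta_J P).1 (Delta_span_phi hs).1
  have h2 := (Delta_span_phi hs).2
  rw [(Delta_J P).2] at h
  rw [nu]
  omega

theorem mem_nongapsLE {u s : ℕ} : s ∈ X.nongapsLE u ↔ s ∈ X.S ∧ s ≤ u := by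
  simp only [nongapsLE, Finset.mem_filter, Finset.mem_range, Nat.lt_succ_iff]
  exact and_comm

theorem du_le_nu {u s : ℕ} (hs : s ∈ X.S) (hsu : s ≤ u) : X.du P u ≤ X.nu P s :=
  Finset.inf'_le _ (mem_nongapsLE.2 ⟨hs, hsu⟩)

theorem sub_le_du (u : ℕ) : (n : ℤ) - u ≤ X.du P u := by
  refine Finset.le_inf' _ _ fun s hs => ?_
  have hs := mem_nongapsLE.1 hs
  have := sub_le_nu P hs.1
  omega

variable {P}

/-- A codeword that is the value of a function with leading monomial `φ_t` has weight at least
`ν(t)`. -/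
theorem nu_le_hammingNorm [DecidableEq F] {f : X.R} {t : ℕ} (h : X.HasLead f t) :
    X.nu P t ≤ hammingNorm (X.ev P f) := by
  -- The ideal of the zeros of `f` among the points contains `J` and all multiples of `f`, whose
  -- leading monomials include every multiple of `φ_t`. Its `Δ` has as many elements as `f` has such
  -- zeros.
  have hsub : X.Delta (vanishing P (Finset.univ.filter fun i => X.ev P f i = 0)) ⊆
      X.Delta (X.J P) ∩ X.Delta (Ideal.span {X.phi t}) := by
    refine Set.subset_inter (Delta_antitone ?_) ?_
    · rw [J_eq_vanishing]
      intro g hg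
      rw [mem_vanishing] at hg ⊢
      exact fun i _ => hg i (Finset.mem_univ i)
    · intro r hr
      rw [mem_Delta_span_phi h.1]
      refine ⟨hr.1, ?_⟩
      rintro ⟨q, hq, rfl⟩
      refine hr.2 (mem_sigma.2 ⟨f * X.phi q, mem_vanishing.2 fun i hi => ?_,
        h.mul (hasLead_phi hq)⟩)
      have : X.evalAt (P i) f = 0 := (Finset.mem_filter.1 hi).2
      rw [evalAt_mul, this, zero_mul]
  have h1 := Set.ncard_le_ncard hsub ((Delta_J P).1.inter_of_left _)
  rw [(Delta_vanishing P _).2] at h1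
  have h2 := nu_add_ncard_inter_le P h.1
  have h3 := Finset.card_filter_add_card_filter_not (s := Finset.univ) fun i => X.ev P f i = 0
  rw [Finset.card_univ, Fintype.card_fin] at h3
  have h4 : hammingNorm (X.ev P f) =
      (Finset.univ.filter fun i => ¬ X.ev P f i = 0).card := rfl
  omega

/-! ### Gröbner bases of ideals -/

theorem exists_minimal_dvd (T : Set ℕ) {t : ℕ} (ht : t ∈ T) :
    ∃ m ∈ T, X.Dvd m t ∧ ∀ m' ∈ T, X.Dvd m' m → m' = m := by
  classical
  have hex : ∃ m, m ∈ T ∧ X.Dvd m t := ⟨t, ht, Dvd.refl t⟩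
  obtain ⟨h1, h2⟩ := Nat.find_spec hex
  refine ⟨_, h1, h2, fun m' hm' hd => ?_⟩
  have := Nat.find_min' hex ⟨hm', hd.trans h2⟩
  have := hd.le
  omega

/-- Congruent nongaps modulo `a` differ by the weight of a power of `x`, so the smaller divides the
larger. Hence there are at most `a` minimal leading monomials. -/
theorem exists_finite_groebnerBasis (I : Ideal X.R) :
    ∃ η : Set X.R, η.Finite ∧ X.IsGroebnerBasis I η := by
  classical
  set T := {t | t ∈ X.sigma I ∧ ∀ t' ∈ X.sigma I, X.Dvd t' t → t' = t} with hT
  have hTfin : T.Finite := by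
    have key : ∀ t ∈ T, ∀ t' ∈ T, t % X.a = t' % X.a → ¬ t < t' := by
      intro t ht t' ht' hmod hlt
      have : X.Dvd t t' := by
        refine ⟨X.a * ((t' - t) / X.a), ⟨(t' - t) / X.a, 0, by simp⟩, ?_⟩
        rw [Nat.mul_div_cancel' ((Nat.modEq_iff_dvd' hlt.le).1 hmod)]
        omega
      exact hlt.ne (ht'.2 t ht.1 this)
    refine Set.Finite.of_injOn (f := (· % X.a)) (t := (Finset.range X.a : Set ℕ)) ?_ ?_
      (Finset.finite_toSet _)
    · intro t _
      simpa using Nat.mod_lt t X.a_pos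
    · intro t ht t' ht' h
      have h1 := key t ht t' ht' h
      have h2 := key t' ht' t ht h.symm
      omega
  have hch : ∀ t ∈ T, ∃ f ∈ I, X.HasLead f t := fun t ht => mem_sigma.1 ht.1
  choose! g hg using hch
  refine ⟨g '' T, hTfin.image g, ?_, ?_⟩
  · rintro _ ⟨t, ht, rfl⟩
    exact ⟨(hg t ht).1, (hg t ht).2.ne_zero⟩
  · intro f hf h0
    obtain ⟨m, hm, hd, hmin⟩ := exists_minimal_dvd (X := X) (X.sigma I)
      (t := X.delta f) ⟨f, hf, h0, rfl⟩
    exact ⟨g m, ⟨m, ⟨hm, hmin⟩, rfl⟩, by rwa [(hg m ⟨hm, hmin⟩).2.delta_eq]⟩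

theorem exists_isInit (v : Fin n → F) : ∃ σ, X.IsInit P v σ := by
  obtain ⟨h, hh⟩ := exists_ev_eq P v
  obtain ⟨η, hη, hB⟩ := exists_finite_groebnerBasis (X.J P)
  by_cases h0 : h = 0
  · exact ⟨⟨-1, _, 0⟩, h, η, hh, hη, hB, rfl, Or.inl ⟨h0, rfl⟩, rfl⟩
  · exact ⟨⟨X.delta h, _, 0⟩, h, η, hh, hη, hB, rfl, Or.inr ⟨h0, rfl⟩, rfl⟩

end MiuraKamiyaCurve
end

/-! ### The module `Rz ⊕ R`: leading monomials, interpolation module, basis update -/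

noncomputable section

/-- The ranking of monomials that realizes the order `>_k`. -/
def Mono.rank (k : ℕ) : Mono → ℕ
  -- Doubling the weights leaves room for the tie-break in favour of `z`.
  | .up t => 2 * (t + k) + 1
  | .down t => 2 * t

theorem Mono.rank_injective (k : ℕ) : Function.Injective (Mono.rank k) := by
  rintro (t | t) (t' | t') h <;> simp only [Mono.rank] at h
  · congr 1; omega
  · omega
  · omega
  · congr 1; omega

theorem Mono.le_iff_rank_le (k : ℕ) (m m' : Mono) : Mono.le k m m' ↔ m.rank k ≤ m'.rank k := by
  rcases m with t | t <;> rcases m' with t' | t' <;>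
    simp only [Mono.le, Mono.weight, Mono.zdeg, Mono.rank] <;> omega

namespace MiuraKamiyaCurve

variable {F : Type*} [Field F] {X : MiuraKamiyaCurve F}

/-! ### Leading monomials in `R z ⊕ R` -/

/-- Ties go to `z`: here `f^D` may reach weight `t + s`, whereas in `isLM_down` the part `f^U z`
must stay strictly below. -/
theorem isLM_up {s : ℤ} {f : X.R × X.R} {t : ℕ} :
    X.IsLM s f (.up t) ↔ X.HasLead f.1 t ∧ f.2 ∈ X.low (t + s + 1) := by
  constructor
  · rintro ⟨⟨h1, h2⟩, h3⟩
    refine ⟨⟨h1, h2, fun r hr h => ?_⟩, fun r hr h => ?_⟩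
    · have := h3 (.up r) ⟨hr, h⟩
      simp only [Mono.le, Mono.weight, Mono.zdeg] at this
      omega
    · have := h3 (.down r) ⟨hr, h⟩
      simp only [Mono.le, Mono.weight, Mono.zdeg] at this
      omega
  · rintro ⟨⟨h1, h2, h3⟩, h4⟩
    refine ⟨⟨h1, h2⟩, ?_⟩
    rintro (r | r) ⟨hr, h⟩
    · have := h3 r hr h
      simp only [Mono.le, Mono.weight, Mono.zdeg]
      omega
    · have := h4 r hr h
      simp only [Mono.le, Mono.weight, Mono.zdeg]
      omega

theorem isLM_down {s : ℤ} {f : X.R × X.R} {t : ℕ} :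
    X.IsLM s f (.down t) ↔ X.HasLead f.2 t ∧ f.1 ∈ X.low (t - s) := by
  constructor
  · rintro ⟨⟨h1, h2⟩, h3⟩
    refine ⟨⟨h1, h2, fun r hr h => ?_⟩, fun r hr h => ?_⟩
    · have := h3 (.down r) ⟨hr, h⟩
      simp only [Mono.le, Mono.weight, Mono.zdeg] at this
      omega
    · have := h3 (.up r) ⟨hr, h⟩
      simp only [Mono.le, Mono.weight, Mono.zdeg] at this
      omega
  · rintro ⟨⟨h1, h2, h3⟩, h4⟩
    refine ⟨⟨h1, h2⟩, ?_⟩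
    rintro (r | r) ⟨hr, h⟩
    · have := h4 r hr h
      simp only [Mono.le, Mono.weight, Mono.zdeg]
      omega
    · have := h3 r hr h
      simp only [Mono.le, Mono.weight, Mono.zdeg]
      omega

theorem IsLM.unique {s : ℤ} {f : X.R × X.R} {m m' : Mono} (h : X.IsLM s f m)
    (h' : X.IsLM s f m') : m = m' := by
  have h1 := h.2 m' h'.1
  have h2 := h'.2 m h.1
  rcases m with t | t <;> rcases m' with t' | t' <;>
    simp only [Mono.le, Mono.weight, Mono.zdeg] at h1 h2 <;> simp <;> omega

theorem exists_isLM (s : ℤ) {f : X.R × X.R} (hf : f ≠ 0) : ∃ m, X.IsLM s f m := by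
  by_cases h1 : f.1 = 0
  · have h2 : f.2 ≠ 0 := fun h2 => hf (Prod.ext h1 h2)
    exact ⟨_, isLM_down.2 ⟨hasLead_delta h2, h1 ▸ Submodule.zero_mem _⟩⟩
  by_cases h2 : f.2 = 0
  · exact ⟨_, isLM_up.2 ⟨hasLead_delta h1, h2 ▸ Submodule.zero_mem _⟩⟩
  by_cases hle : (X.delta f.2 : ℤ) ≤ X.delta f.1 + s
  · exact ⟨_, isLM_up.2 ⟨hasLead_delta h1, low_mono (by omega) (hasLead_delta h2).2.2⟩⟩
  · exact ⟨_, isLM_down.2 ⟨hasLead_delta h2, low_mono (by omega) (hasLead_delta h1).2.2⟩⟩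

theorem IsLM.idx_mem {s : ℤ} {f : X.R × X.R} {m : Mono} (h : X.IsLM s f m) : m.idx ∈ X.S :=
  h.1.1

theorem IsLM.ne_zero {s : ℤ} {f : X.R × X.R} {m : Mono} (h : X.IsLM s f m) : f ≠ 0 := by
  rintro rfl
  rcases m with t | t
  · exact h.1.2 (X.coeff_zero t)
  · exact h.1.2 (X.coeff_zero t)

variable (X) in
/-- The monomials `φ_t` such that `φ_t z` is divisible by no leading monomial of `B`. -/
def upDelta (s : ℤ) (B : Set (X.R × X.R)) : Set ℕ :=
  {t | t ∈ X.S ∧ ∀ f ∈ B, ∀ p, X.IsLM s f (.up p) → ¬ X.Dvd p t}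

variable (X) in
/-- The monomials `φ_t` that are divisible by no leading monomial of `B`. -/
def downDelta (s : ℤ) (B : Set (X.R × X.R)) : Set ℕ :=
  {t | t ∈ X.S ∧ ∀ f ∈ B, ∀ p, X.IsLM s f (.down p) → ¬ X.Dvd p t}

theorem DeltaGen_downPart (s : ℤ) (B : Set (X.R × X.R)) :
    X.DeltaGen (Prod.snd '' X.downPart s B) = X.downDelta s B := by
  ext t
  rw [DeltaGen, Set.mem_sdiff]
  refine and_congr_right fun _ => ⟨fun h f hf p hp hd => h ?_, ?_⟩
  · have hl := (isLM_down.1 hp).1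
    exact ⟨f.2, ⟨f, ⟨hf, p, hp⟩, rfl⟩, hl.ne_zero, by rwa [hl.delta_eq]⟩
  · rintro h ⟨_, ⟨f, ⟨hf, p, hp⟩, rfl⟩, -, hd⟩
    rw [(isLM_down.1 hp).1.delta_eq] at hd
    exact h f hf p hp hd

/-! ### The interpolation module -/

variable {n : ℕ} (P : Fin n ↪ X.Point)

/-- The module of the `f ∈ R z ⊕ R` whose values at `z = r` vanish at all the points. -/
def interp (r : Fin n → F) : Submodule X.R (X.R × X.R) where
  carrier := {f | ∀ i, X.evalAt (P i) f.1 * r i + X.evalAt (P i) f.2 = 0}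
  add_mem' {f g} hf hg i := by
    have e : X.evalAt (P i) (f + g).1 * r i + X.evalAt (P i) (f + g).2 =
        (X.evalAt (P i) f.1 * r i + X.evalAt (P i) f.2) +
        (X.evalAt (P i) g.1 * r i + X.evalAt (P i) g.2) := by
      rw [Prod.fst_add, Prod.snd_add, evalAt_add, evalAt_add]; ring
    rw [e, hf i, hg i, add_zero]
  zero_mem' i := by rw [Prod.fst_zero, Prod.snd_zero, evalAt_zero]; simp
  smul_mem' c f hf i := by
    have e : X.evalAt (P i) (c • f).1 * r i + X.evalAt (P i) (c • f).2 =
        X.evalAt (P i) c * (X.evalAt (P i) f.1 * r i + X.evalAt (P i) f.2) := by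
      rw [Prod.smul_fst, Prod.smul_snd, smul_eq_mul, smul_eq_mul, evalAt_mul, evalAt_mul]; ring
    rw [e, hf i, mul_zero]

variable {P}

variable (X) in
/-- All coefficients of an element of `R z ⊕ R`, as a linear map. -/
def coeffHom₂ : X.R × X.R →ₗ[F] Mono → F where
  toFun f m := X.coeff₂ f m
  map_add' f g := by
    funext m; rcases m with t | t
    · exact X.coeff_add _ _ _
    · exact X.coeff_add _ _ _
  map_smul' c f := by
    funext m; rcases m with t | t
    · exact X.coeff_smul _ _ _
    · exact X.coeff_smul _ _ _

theorem isLeadIndex₂_iff {k : ℕ} {f : X.R × X.R} {m : Mono} :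
    IsLeadIndex {m | m.idx ∈ X.S} X.coeffHom₂ (Mono.rank k) f m ↔ X.IsLM k f m := by
  refine and_congr_right fun _ => forall_congr' fun m' => ?_
  rw [Mono.le_iff_rank_le]
  exact Iff.rfl

theorem finite_supp (f : X.R × X.R) : (X.supp f).Finite := by
  refine (((X.finite_support f.1).image Mono.up).union
    ((X.finite_support f.2).image Mono.down)).subset ?_
  rintro (t | t) ⟨ht, h⟩
  · exact Or.inl ⟨t, ⟨ht, h⟩, rfl⟩
  · exact Or.inr ⟨t, ⟨ht, h⟩, rfl⟩

variable (P) in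
theorem ncard_not_lead_interp (k : ℕ) (r : Fin n → F) :
    {m : Mono | m.idx ∈ X.S ∧ ¬ ∃ f ∈ interp P r, X.IsLM k f m}.ncard = n := by
  let L : X.R × X.R →ₗ[F] (Fin n → F) :=
    { toFun := fun f i => X.evalAt (P i) f.1 * r i + X.evalAt (P i) f.2
      map_add' := fun f g => by
        funext i
        simp only [Prod.fst_add, Prod.snd_add, evalAt_add, Pi.add_apply]; ring
      map_smul' := fun c f => by
        funext i
        simp only [Prod.smul_fst, Prod.smul_snd, evalAt_smul, Pi.smul_apply, RingHom.id_apply,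
          smul_eq_mul]
        ring }
  have hL : Function.Surjective L := by
    intro w
    obtain ⟨f, hf⟩ := exists_ev_eq P w
    -- Elements without `z` already realize all value vectors, whatever `r` is.
    refine ⟨(0, f), funext fun i => ?_⟩
    have := congrFun hf i
    change X.evalAt (P i) 0 * r i + X.evalAt (P i) f = w i
    rw [evalAt_zero, zero_mul, zero_add]
    exact this
  have h := ncard_not_lead_ker (M := {m : Mono | m.idx ∈ X.S}) (c := X.coeffHom₂) (rk := Mono.rank k)
    (fun v hv => Prod.ext (X.eq_zero_of_coeff fun t ht => hv (.up t) ht)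
      (X.eq_zero_of_coeff fun t ht => hv (.down t) ht)) finite_supp
    (fun m => match m with
      | .up t => (X.phi t, 0)
      | .down t => (0, X.phi t))
    (by
      classical
      rintro (s | s) hs (t | t) ht
      · change X.coeff (X.phi s) t = _
        rw [X.coeff_phi (s := s) (t := t) hs ht]
        simp [Set.indicator_apply]
      · change X.coeff 0 t = _
        simp [X.coeff_zero]
      · change X.coeff 0 t = _
        simp [X.coeff_zero]
      · change X.coeff (X.phi s) t = _
        rw [X.coeff_phi (s := s) (t := t) hs ht]
        simp [Set.indicator_apply])
    (Mono.rank_injective k) L hL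
  have e : {m | m ∈ {m : Mono | m.idx ∈ X.S} ∧ ¬∃ v, L v = 0 ∧
      IsLeadIndex {m | m.idx ∈ X.S} X.coeffHom₂ (Mono.rank k) v m} =
      {m : Mono | m.idx ∈ X.S ∧ ¬ ∃ f ∈ interp P r, X.IsLM k f m} := by
    ext m
    simp only [isLeadIndex₂_iff]
    have : ∀ f, L f = 0 ↔ f ∈ interp P r := fun f => funext_iff
    simp only [this]
    exact Iff.rfl
  rw [e] at h
  simpa using h.2

/-- A set of elements of the interpolation module whose leading monomials leave out at most `n`
monomials is a Gröbner basis. -/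
theorem interp_groebner {k : ℕ} {r : Fin n → F} {B : Set (X.R × X.R)}
    (hB : B ⊆ interp P r) (hU : (X.upDelta k B).Finite) (hD : (X.downDelta k B).Finite)
    (hcard : (X.upDelta k B).ncard + (X.downDelta k B).ncard ≤ n) :
    (X.upDelta k B).ncard + (X.downDelta k B).ncard = n ∧
    ∀ f ∈ interp P r, ∀ t, (X.IsLM k f (.up t) → t ∉ X.upDelta k B) ∧
      (X.IsLM k f (.down t) → t ∉ X.downDelta k B) := by
  have hsub : {m : Mono | m.idx ∈ X.S ∧ ¬ ∃ f ∈ interp P r, X.IsLM k f m} ⊆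
      Mono.up '' X.upDelta k B ∪ Mono.down '' X.downDelta k B := by
    rintro (t | t) ⟨ht, h⟩
    · refine Or.inl ⟨t, ⟨ht, fun f hf p hp hd => h ?_⟩, rfl⟩
      obtain ⟨q, hq, rfl⟩ := hd
      refine ⟨X.phi q • f, Submodule.smul_mem _ _ (hB hf), isLM_up.2 ?_⟩
      rw [isLM_up] at hp
      refine ⟨add_comm p q ▸ (hasLead_phi hq).mul hp.1, ?_⟩
      exact low_mono (by push_cast; omega) (mul_mem_low (hasLead_phi hq).2.2 hp.2)
    · refine Or.inr ⟨t, ⟨ht, fun f hf p hp hd => h ?_⟩, rfl⟩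
      obtain ⟨q, hq, rfl⟩ := hd
      refine ⟨X.phi q • f, Submodule.smul_mem _ _ (hB hf), isLM_down.2 ?_⟩
      rw [isLM_down] at hp
      refine ⟨add_comm p q ▸ (hasLead_phi hq).mul hp.1, ?_⟩
      exact low_mono (by push_cast; omega) (mul_mem_low (hasLead_phi hq).2.2 hp.2)
  have hfin : (Mono.up '' X.upDelta k B ∪ Mono.down '' X.downDelta k B).Finite :=
    (hU.image _).union (hD.image _)
  have hncard : (Mono.up '' X.upDelta k B ∪ Mono.down '' X.downDelta k B).ncard =
      (X.upDelta k B).ncard + (X.downDelta k B).ncard := by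
    rw [Set.ncard_union_eq _ (hU.image _) (hD.image _),
      Set.ncard_image_of_injective _ fun a b h => Mono.up.inj h,
      Set.ncard_image_of_injective _ fun a b h => Mono.down.inj h]
    rw [Set.disjoint_left]
    rintro _ ⟨t, -, rfl⟩ ⟨t', -, h⟩
    exact Mono.noConfusion h
  have hle := Set.ncard_le_ncard hsub hfin
  rw [ncard_not_lead_interp, hncard] at hle
  -- The monomials missing for the whole module number exactly `n` and are all missing for `B`; with
  -- at most `n` missing for `B`, the two sets coincide.
  have heq := Set.eq_of_subset_of_ncard_le hsub
    (by rw [ncard_not_lead_interp, hncard]; exact hcard) hfin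
  refine ⟨le_antisymm hcard hle, fun f hf t => ⟨fun h ht => ?_, fun h ht => ?_⟩⟩
  · have : Mono.up t ∈ {m : Mono | m.idx ∈ X.S ∧ ¬ ∃ f ∈ interp P r, X.IsLM k f m} :=
      heq ▸ Or.inl ⟨t, ht, rfl⟩
    exact this.2 ⟨f, hf, h⟩
  · have : Mono.down t ∈ {m : Mono | m.idx ∈ X.S ∧ ¬ ∃ f ∈ interp P r, X.IsLM k f m} :=
      heq ▸ Or.inr ⟨t, ht, rfl⟩
    exact this.2 ⟨f, hf, h⟩

/-! ### Step M2 -/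

theorem quotTerm_hasLead {g : X.R} {t l : ℕ} (hg : X.HasLead g t) (hd : X.Dvd t l) :
    X.HasLead (X.quotTerm l g) (l - t) ∧ X.HasLead (X.quotTerm l g * g) l ∧
      X.coeff (X.quotTerm l g * g) l = 1 := by
  obtain ⟨q, hq, rfl⟩ := hd
  have e : t + q - t = q := by omega
  have hm : X.HasLead (X.phi q * g) (t + q) := add_comm q t ▸ (hasLead_phi hq).mul hg
  have hlc : X.lc (X.phi q * g) = X.coeff (X.phi q * g) (t + q) := by rw [lc, hm.delta_eq]
  have hq' : X.quotTerm (t + q) g = (X.coeff (X.phi q * g) (t + q))⁻¹ • X.phi q := by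
    rw [quotTerm, hg.delta_eq, e, hlc, const_mul]
  rw [hq', e, smul_mul_assoc]
  refine ⟨(hasLead_phi hq).smul (inv_ne_zero hm.2.1), hm.smul (inv_ne_zero hm.2.1), ?_⟩
  rw [coeff_smul, inv_mul_cancel₀ hm.2.1]

/-- When the leading monomial of `f` moves from `φ_t z` to `φ_{t+k}`, its combination with `g`
at a common multiple `φ_l` has leading monomial `φ_{l-k} z`. -/
theorem isLM_scomb {k t p l : ℕ} {f g : X.R × X.R} (hf : X.IsLM k f (.up t))
    (hf' : X.IsLM (k - 1) f (.down (t + k))) (hg : X.IsLM k g (.down p))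
    (ht : X.Dvd (t + k) l) (hp : X.Dvd p l) :
    X.IsLM (k - 1) (X.scomb l f g) (.up (l - k)) := by
  rw [isLM_up] at hf
  rw [isLM_down] at hf' hg
  obtain ⟨hf1, hf2, hf3⟩ := quotTerm_hasLead hf'.1 ht
  obtain ⟨hg1, hg2, hg3⟩ := quotTerm_hasLead hg.1 hp
  have htl := ht.le
  have hpl := hp.le
  rw [isLM_up]
  constructor
  · have h1 := hf1.mul hf.1
    have e : l - (t + k) + t = l - k := by omega
    rw [e] at h1
    -- As `lm_k(g)` lies in `R`, the multiple of `g^U` stays strictly below `l - k` and cannot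
    -- disturb the leading term coming from `f^U`.
    refine h1.sub_low (low_mono ?_ (mul_mem_low hg1.2.2 hg.2))
    omega
  -- Both multiples are normalized to coefficient 1 at `φ_l`, so that term cancels.
  · have : (X.scomb l f g).2 ∈ X.low l := by
      refine mem_low_of_coeff_eq_zero (Submodule.sub_mem _ hf2.2.2 hg2.2.2) fun _ => ?_
      change X.coeff (X.quotTerm l f.2 * f.2 - X.quotTerm l g.2 * g.2) l = 0
      rw [coeff_sub, hf3, hg3, sub_self]
    exact low_mono (by omega) this

/-- Lowering the weight of `z` by one matters only in a tie: the one monomial of `R` that can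
overtake `φ_t z` is `φ_{t+k}`. -/
theorem isLM_pred_of_up {k t : ℕ} {f : X.R × X.R} (hf : X.IsLM k f (.up t)) :
    X.IsLM (k - 1) f (.up t) ∨ X.IsLM (k - 1) f (.down (t + k)) := by
  obtain ⟨m, hm⟩ := exists_isLM ((k : ℤ) - 1) hf.ne_zero
  rw [isLM_up] at hf
  rcases m with r | r
  · left
    rwa [hf.1.unique (isLM_up.1 hm).1]
  · right
    have h := isLM_down.1 hm
    have h1 := hf.2 r h.1.1 h.1.2.1
    have h2 := h.2 t hf.1.1 hf.1.2.1
    have : r = t + k := by omega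
    rwa [← this]

theorem isLM_pred_of_down {s : ℤ} {t : ℕ} {f : X.R × X.R} (hf : X.IsLM s f (.down t)) :
    X.IsLM (s - 1) f (.down t) := by
  rw [isLM_down] at hf ⊢
  exact ⟨hf.1, low_mono (by omega) hf.2⟩

theorem down_index_eq {k t r : ℕ} {f : X.R × X.R} (hf : X.IsLM k f (.up t))
    (h : X.IsLM (k - 1) f (.down r)) : r = t + k := by
  rcases isLM_pred_of_up hf with h' | h'
  · exact absurd (h.unique h') (by simp)
  · exact Mono.down.inj (h.unique h')

theorem exists_isLcm_dvd {s t m : ℕ} (hs : X.Dvd s m) (ht : X.Dvd t m) :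
    ∃ l, X.IsLcm s t l ∧ X.Dvd l m := by
  obtain ⟨l, h1, h2, h3⟩ := exists_minimal_dvd (X := X) {l | X.IsCommonMultiple s t l}
    (t := m) ⟨hs, ht⟩
  exact ⟨l, ⟨h1, h3⟩, h2⟩

/-- All the elements that can occur in `spoly(f)` have their leading monomial in `R z`. -/
theorem IsSpoly.isLM {k t : ℕ} {G A : Set (X.R × X.R)} {f : X.R × X.R}
    (hf : X.IsLM k f (.up t)) (h : X.IsSpoly k G f A) :
    ∀ g ∈ A, ∃ r, X.IsLM (k - 1) g (.up r) := by
  rcases h with ⟨r, hr, rfl⟩ | ⟨r, hr, g, -, p, hp, hd, rfl⟩ | ⟨r, hr, -, rfl⟩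
  · rintro _ rfl
    exact ⟨r, hr⟩
  · rintro _ rfl
    obtain rfl := down_index_eq hf hr
    exact ⟨_, isLM_scomb hf hr hp (Dvd.refl _) hd⟩
  · rintro _ ⟨g, -, p, l, hp, hl, rfl⟩
    obtain rfl := down_index_eq hf hr
    exact ⟨_, isLM_scomb hf hr hp hl.1.1 hl.1.2⟩

theorem IsSpoly.subset {k : ℕ} {M : Submodule X.R (X.R × X.R)} {G A : Set (X.R × X.R)}
    {f : X.R × X.R} (hG : G ⊆ M) (hf : f ∈ M) (h : X.IsSpoly k G f A) : A ⊆ M := by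
  have hs : ∀ g ∈ G, ∀ l, X.scomb l f g ∈ M := fun g hg l =>
    Submodule.sub_mem _ (Submodule.smul_mem _ _ hf) (Submodule.smul_mem _ _ (hG hg))
  rcases h with ⟨r, hr, rfl⟩ | ⟨r, hr, g, hg, p, hp, hd, rfl⟩ | ⟨r, hr, -, rfl⟩
  · rintro _ rfl
    exact hf
  · rintro _ rfl
    exact hs g hg _
  · rintro _ ⟨g, hg, p, l, hp, hl, rfl⟩
    exact hs g hg _

theorem exists_isSpoly {k t : ℕ} (G : Set (X.R × X.R)) {f : X.R × X.R}
    (hf : X.IsLM k f (.up t)) (hG : ∀ g ∈ G, ∃ p, X.IsLM k g (.down p)) :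
    ∃ A, X.IsSpoly k G f A := by
  rcases isLM_pred_of_up hf with h | h
  · exact ⟨_, Or.inl ⟨t, h, rfl⟩⟩
  by_cases hd : ∃ g ∈ G, ∃ p, X.IsLM k g (.down p) ∧ X.Dvd p (t + k)
  · obtain ⟨g, hg, p, hp, hd⟩ := hd
    exact ⟨_, Or.inr (Or.inl ⟨_, h, g, hg, p, hp, hd, rfl⟩)⟩
  · refine ⟨_, Or.inr (Or.inr ⟨_, h, ⟨h.idx_mem, fun g hg m hm hdvd => ?_⟩, rfl⟩)⟩
    obtain ⟨p, hp⟩ := hG g hg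
    obtain rfl := hm.unique hp
    exact hd ⟨g, hg, p, hp, hdvd⟩

theorem MonoDvd.trans {m p q : Mono} (h : X.MonoDvd m p) (h' : X.MonoDvd p q) :
    X.MonoDvd m q := by
  rcases m with m | m <;> rcases p with p | p <;> rcases q with q | q <;>
    first | exact Dvd.trans h h' | exact h.elim | exact h'.elim

theorem MonoDvd.refl (m : Mono) : X.MonoDvd m m := by
  rcases m with m | m <;> exact Dvd.refl m

theorem MonoDvd.eq_of_idx_le {m p : Mono} (h : X.MonoDvd m p) (hle : p.idx ≤ m.idx) : m = p := by
  rcases m with m | m <;> rcases p with p | p <;>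
    first
    | exact h.elim
    | (have h1 := Dvd.le (X := X) h
       have h2 : p ≤ m := hle
       congr 1; omega)

theorem exists_isReduction (s : ℤ) {A : Set (X.R × X.R)} (hA : ∀ f ∈ A, ∃ m, X.IsLM s f m) :
    ∃ A', X.IsReduction s A A' := by
  classical
  have : Nonempty Mono := ⟨.up 0⟩
  choose! lm hlm using hA
  have hmin : ∀ f ∈ A, ∃ g ∈ A, X.MonoDvd (lm g) (lm f) ∧
      ∀ g' ∈ A, X.MonoDvd (lm g') (lm g) → lm g' = lm g := by
    intro f hf
    have hex : ∃ N, ∃ g ∈ A, X.MonoDvd (lm g) (lm f) ∧ (lm g).idx = N :=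
      ⟨_, f, hf, MonoDvd.refl _, rfl⟩
    obtain ⟨g, hg, hd, hN⟩ := Nat.find_spec hex
    refine ⟨g, hg, hd, fun g' hg' hd' => hd'.eq_of_idx_le ?_⟩
    rw [hN]
    exact Nat.find_min' hex ⟨g', hg', hd'.trans hd, rfl⟩
  -- Representatives are chosen per minimal monomial, not per element, so that two elements with the
  -- same leading monomial do not both survive.
  set T := {m | ∃ g ∈ A, lm g = m ∧ ∀ g' ∈ A, X.MonoDvd (lm g') (lm g) → lm g' = lm g} with hT
  have hch : ∀ m ∈ T, ∃ g ∈ A, lm g = m ∧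
      ∀ g' ∈ A, X.MonoDvd (lm g') (lm g) → lm g' = lm g := fun m hm => hm
  choose! rep hrep using hch
  refine ⟨rep '' T, ?_, ?_, ?_⟩
  · rintro _ ⟨m, hm, rfl⟩
    exact (hrep m hm).1
  · intro f hf
    obtain ⟨g, hg, hd, hg'⟩ := hmin f hf
    have hT : lm g ∈ T := ⟨g, hg, rfl, hg'⟩
    obtain ⟨h1, h2, -⟩ := hrep _ hT
    exact ⟨rep (lm g), ⟨_, hT, rfl⟩, lm f, lm (rep (lm g)), hlm f hf, hlm _ h1, by rwa [h2]⟩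
  · rintro _ ⟨m, hm, rfl⟩ _ ⟨p, hp, rfl⟩ m' p' hm' hp' hd
    obtain ⟨h1, h2, h3⟩ := hrep m hm
    obtain ⟨h4, h5, -⟩ := hrep p hp
    rw [hm'.unique (hlm _ h1), hp'.unique (hlm _ h4)] at hd
    have := h3 _ h4 hd
    rw [h2, h5] at this
    rw [this]

theorem exists_isUpdate (k : ℕ) (B : Set (X.R × X.R)) : ∃ B', X.IsUpdate k B B' := by
  have hA : ∀ f ∈ X.upPart k B, ∃ A, X.IsSpoly k (X.downPart k B) f A := by
    rintro f ⟨-, t, ht⟩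
    exact exists_isSpoly _ ht fun g hg => hg.2
  choose! A hA using hA
  obtain ⟨B₁, h₁⟩ := exists_isReduction (X := X) ((k : ℤ) - 1)
    (A := X.downPart k B ∪ {f | f ∈ X.upPart k B ∧ ∃ t, X.IsLM ((k : ℤ) - 1) f (.down t) ∧
      Mono.down t ∈ X.DeltaGen₂ k (X.downPart k B)}) (by
        rintro f (⟨-, t, ht⟩ | ⟨-, t, ht, -⟩)
        · exact ⟨_, isLM_pred_of_down ht⟩
        · exact ⟨_, ht⟩)
  obtain ⟨B₂, h₂⟩ := exists_isReduction (X := X) ((k : ℤ) - 1)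
    (A := ⋃ f ∈ X.upPart k B, A f) (by
        intro g hg
        simp only [Set.mem_iUnion] at hg
        obtain ⟨f, hf, hg⟩ := hg
        obtain ⟨t, ht⟩ := hf.2
        obtain ⟨r, hr⟩ := (hA f hf).isLM ht g hg
        exact ⟨_, hr⟩)
  exact ⟨B₁ ∪ B₂, A, B₁, B₂, hA, h₁, h₂, rfl⟩

theorem IsUpdate.subset {k : ℕ} {M : Submodule X.R (X.R × X.R)} {B B' : Set (X.R × X.R)}
    (hB : B ⊆ M) (h : X.IsUpdate k B B') : B' ⊆ M := by
  obtain ⟨A, B₁, B₂, hA, h₁, h₂, rfl⟩ := h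
  rintro g (hg | hg)
  · rcases h₁.1 hg with hg | hg
    · exact hB hg.1
    · exact hB hg.1.1
  · have hg := h₂.1 hg
    simp only [Set.mem_iUnion] at hg
    obtain ⟨f, hf, hg⟩ := hg
    exact (hA f hf).subset (fun g hg => hB hg.1) (hB hf.1) hg

/-- The number of monomials divisible by no leading monomial does not increase in step M2. -/
theorem IsUpdate.ncard_le {k : ℕ} {B B' : Set (X.R × X.R)} (h : X.IsUpdate k B B')
    (hU : (X.upDelta k B).Finite) (hD : (X.downDelta k B).Finite) :
    (X.upDelta (k - 1) B').Finite ∧ (X.downDelta (k - 1) B').Finite ∧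
    (X.upDelta (k - 1) B').ncard + (X.downDelta (k - 1) B').ncard ≤
      (X.upDelta k B).ncard + (X.downDelta k B).ncard := by
  obtain ⟨A, B₁, B₂, hA, h₁, h₂, rfl⟩ := h
  have hD₁ : ∀ f ∈ X.downPart k B ∪ {f | f ∈ X.upPart k B ∧
      ∃ t, X.IsLM ((k : ℤ) - 1) f (.down t) ∧ Mono.down t ∈ X.DeltaGen₂ k (X.downPart k B)},
      ∀ p, X.IsLM (k - 1) f (.down p) → ∀ t ∈ X.downDelta (k - 1) (B₁ ∪ B₂), ¬ X.Dvd p t := by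
    intro f hf p hp t ht hd
    obtain ⟨g, hg, m, q, hm, hq, hdvd⟩ := h₁.2.1 f hf
    obtain rfl := hm.unique hp
    rcases q with q | q
    · exact hdvd
    · exact ht.2 g (Or.inl hg) q hq (Dvd.trans hdvd hd)
  have hU₂ : ∀ f ∈ X.upPart k B, ∀ g ∈ A f, ∀ p, X.IsLM (k - 1) g (.up p) →
      ∀ t ∈ X.upDelta (k - 1) (B₁ ∪ B₂), ¬ X.Dvd p t := by
    intro f hf g hg p hp t ht hd
    obtain ⟨g', hg', m, q, hm, hq, hdvd⟩ := h₂.2.1 g (by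
      simp only [Set.mem_iUnion]; exact ⟨f, hf, hg⟩)
    obtain rfl := hm.unique hp
    rcases q with q | q
    · exact ht.2 g' (Or.inr hg') q hq (Dvd.trans hdvd hd)
    · exact hdvd
  have hDsub : X.downDelta (k - 1) (B₁ ∪ B₂) ⊆ X.downDelta k B := by
    intro t ht
    exact ⟨ht.1, fun f hf p hp => hD₁ f (Or.inl ⟨hf, p, hp⟩) p (isLM_pred_of_down hp) t ht⟩
  -- If `φ_m z` was covered by some `f` and is no longer, then `f` moved into the `R` part and now
  -- covers `φ_{m+k}`. Had some `G_i` covered `φ_{m+k}` before, the combination at an lcm dividing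
  -- it would cover `φ_m z`. So `m ↦ m + k` sends new gaps in `Rz` to gaps in `R` that have been
  -- filled.
  have hUsub : X.upDelta (k - 1) (B₁ ∪ B₂) ⊆ X.upDelta k B ∪
      (· + k) ⁻¹' (X.downDelta k B \ X.downDelta (k - 1) (B₁ ∪ B₂)) := by
    intro m hm
    by_contra hnot
    rw [Set.mem_union, not_or] at hnot
    obtain ⟨hmU, hmD⟩ := hnot
    have : ∃ f ∈ B, ∃ t, X.IsLM k f (.up t) ∧ X.Dvd t m := by
      by_contra hno
      exact hmU ⟨hm.1, fun f hf t ht hd => hno ⟨f, hf, t, ht, hd⟩⟩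
    obtain ⟨f, hf, t, ht, hd⟩ := this
    have hfU : f ∈ X.upPart k B := ⟨hf, t, ht⟩
    have hd' : X.Dvd (t + k) (m + k) := by
      obtain ⟨q, hq, rfl⟩ := hd
      exact ⟨q, hq, by omega⟩
    have hsp := hA f hfU
    have hU₂ := hU₂ f hfU
    rcases hsp with ⟨r, hr, hAf⟩ | ⟨r, hr, g, -, p, hp, hdp, hAf⟩ | ⟨r, hr, hbad, hAf⟩
    · rw [hAf] at hU₂
      rw [← (isLM_up.1 ht).1.unique (isLM_up.1 hr).1] at hr
      exact hU₂ f rfl t hr m hm hd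
    · obtain rfl := down_index_eq ht hr
      rw [hAf] at hU₂
      refine hU₂ _ rfl _ (isLM_scomb ht hr hp (Dvd.refl _) hdp) m hm ?_
      rwa [Nat.add_sub_cancel]
    · obtain rfl := down_index_eq ht hr
      refine hmD ⟨?_, fun hmem => hD₁ f (Or.inr ⟨hfU, _, hr, hbad⟩) _ hr _ hmem hd'⟩
      refine ⟨dvd_left_mem hr.idx_mem hd', fun g hg p hp hdp => ?_⟩
      obtain ⟨l, hl, hlm⟩ := exists_isLcm_dvd hd' hdp
      rw [hAf] at hU₂
      refine hU₂ _ ⟨g, ⟨hg, p, hp⟩, p, l, hp, hl, rfl⟩ _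
        (isLM_scomb ht hr hp hl.1.1 hl.1.2) m hm ?_
      obtain ⟨q, hq, hq'⟩ := hlm
      have := hl.1.1.le
      exact ⟨q, hq, by omega⟩
  have hinj : Function.Injective (· + k : ℕ → ℕ) := add_left_injective k
  have hfin' : ((· + k) ⁻¹' (X.downDelta k B \ X.downDelta (k - 1) (B₁ ∪ B₂))).Finite :=
    (hD.sdiff).preimage hinj.injOn
  have hDfin := hD.subset hDsub
  refine ⟨(hU.union hfin').subset hUsub, hDfin, ?_⟩
  have h1 := Set.ncard_le_ncard hUsub (hU.union hfin')
  have h2 := Set.ncard_union_le (X.upDelta k B)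
    ((· + k) ⁻¹' (X.downDelta k B \ X.downDelta (k - 1) (B₁ ∪ B₂)))
  have h3 : ((· + k) ⁻¹' (X.downDelta k B \ X.downDelta (k - 1) (B₁ ∪ B₂))).ncard ≤
      (X.downDelta k B \ X.downDelta (k - 1) (B₁ ∪ B₂)).ncard :=
    Set.ncard_le_ncard_of_injOn (· + k) (fun _ h => h) hinj.injOn hD.sdiff
  have h4 := Set.ncard_sdiff_add_ncard_of_subset hDsub hD
  omega

end MiuraKamiyaCurve
end

/-! ### The majority vote and the loop invariant -/

noncomputable section
namespace MiuraKamiyaCurve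

variable {F : Type*} [Field F] {X : MiuraKamiyaCurve F} {n : ℕ} {P : Fin n ↪ X.Point}

/-! ### Step M1 -/

/-- The added term `w φ_k f^U` has at most the weight of `f^U z` for `>_k`: harmless when the
leading monomial is in `Rz`, and strictly lower when it is in `R`. -/
theorem isLM_shift {k : ℕ} (hk : k ∈ X.S) (w : F) {f : X.R × X.R} {m : Mono}
    (h : X.IsLM k f m) : X.IsLM k (X.shift k w f) m := by
  have e : X.shift k w f = (f.1, f.2 + w • (X.phi k * f.1)) := by
    rw [shift, mul_assoc, const_mul]
  rw [e]
  rcases m with t | t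
  · rw [isLM_up] at h ⊢
    refine ⟨h.1, Submodule.add_mem _ h.2 (Submodule.smul_mem _ _ ?_)⟩
    exact low_mono (by omega) (mul_mem_low (hasLead_phi hk).2.2 h.1.2.2)
  · rw [isLM_down] at h ⊢
    refine ⟨h.1.add_low (Submodule.smul_mem _ _ ?_), h.2⟩
    exact low_mono (by omega) (mul_mem_low (hasLead_phi hk).2.2 h.2)

theorem upDelta_shift_subset {k : ℕ} (hk : k ∈ X.S) (w : F) (B : Set (X.R × X.R)) :
    X.upDelta k (X.shift k w '' B) ⊆ X.upDelta k B := fun _ ht =>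
  ⟨ht.1, fun f hf p hp => ht.2 _ ⟨f, hf, rfl⟩ p (isLM_shift hk w hp)⟩

theorem downDelta_shift_subset {k : ℕ} (hk : k ∈ X.S) (w : F) (B : Set (X.R × X.R)) :
    X.downDelta k (X.shift k w '' B) ⊆ X.downDelta k B := fun _ ht =>
  ⟨ht.1, fun f hf p hp => ht.2 _ ⟨f, hf, rfl⟩ p (isLM_shift hk w hp)⟩

theorem shift_mem_interp {k : ℕ} {w : F} {μ : X.R} {e : Fin n → F} {f : X.R × X.R}
    (hf : f ∈ interp P fun i => e i + X.evalAt (P i) (μ + w • X.phi k)) :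
    X.shift k w f ∈ interp P fun i => e i + X.evalAt (P i) μ := by
  intro i
  have := hf i
  beta_reduce at this ⊢
  rw [evalAt_add, evalAt_smul] at this
  simp only [shift]
  rw [evalAt_add, evalAt_mul, evalAt_mul, evalAt_const, ← this]
  ring

theorem HasLead.coeff_mul_add {k t : ℕ} {w : F} {μ f g : X.R} (hk : k ∈ X.S)
    (hμ : μ ∈ X.low k) (hf : X.HasLead f t) :
    X.coeff (f * (μ + w • X.phi k) + g) (t + k) =
      w * X.coeff (f * X.phi k) (t + k) + X.coeff g (t + k) := by
  rw [mul_add, mul_smul_comm, coeff_add, coeff_add, coeff_smul,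
    coeff_eq_zero_of_mem_low (mul_mem_low hf.2.2 hμ) (X.add_mem_S hf.1 hk) (by push_cast; omega),
    zero_add]

theorem vote_eq {k t : ℕ} (hk : k ∈ X.S) {f : X.R × X.R} (hf : X.HasLead f.1 t) :
    X.vote k f = -(X.coeff f.2 (t + k) / X.coeff (f.1 * X.phi k) (t + k)) := by
  rw [vote, lc, (hf.mul (hasLead_phi hk)).delta_eq]

/-- If the error is small, then the coefficient of the message beats all other candidates. -/
theorem vote_majority [DecidableEq F] {k : ℕ} (hk : k ∈ X.S) {w : F} {μ : X.R}
    (hμ : μ ∈ X.low k) {e : Fin n → F} (he : 2 * (hammingNorm e : ℤ) < X.nu P k)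
    {B : Set (X.R × X.R)} (hB : B ⊆ interp P fun i => e i + X.evalAt (P i) (μ + w • X.phi k))
    (hU : (X.upDelta k B).Finite) (hD : (X.downDelta k B).Finite)
    (hcard : (X.upDelta k B).ncard + (X.downDelta k B).ncard ≤ n) :
    w ∈ X.W k B ∧ ∀ c, c ≠ w → X.dc k B c < X.dc k B w := by
  obtain ⟨hcard, hGB⟩ := interp_groebner hB hU hD hcard
  set U := X.upDelta k B
  set D := X.downDelta k B
  set ν := μ + w • X.phi k with hν
  have hνlow : ν ∈ X.low (k + 1) :=
    Submodule.add_mem _ (low_mono (by omega) hμ) (Submodule.smul_mem _ _ (hasLead_phi hk).2.2)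
  set V := vanishing P (Finset.univ.filter fun i => e i = 0) with hV
  have hVmem : ∀ f ∈ B, f.1 * ν + f.2 ∈ V := by
    intro f hf
    rw [hV, mem_vanishing]
    intro i hi
    have h0 : e i = 0 := (Finset.mem_filter.1 hi).2
    have := hB hf i
    beta_reduce at this
    rw [h0, zero_add] at this
    rw [evalAt_add, evalAt_mul, this]
  have hVcard : (X.Delta V).ncard + hammingNorm e = n := by
    rw [hV, (Delta_vanishing P _).2]
    have h := Finset.card_filter_add_card_filter_not (s := Finset.univ) fun i => e i = 0
    rwa [Finset.card_univ, Fintype.card_fin] at h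
  have hVsigma : ∀ {f : X.R} {s t : ℕ}, f ∈ V → X.HasLead f s → X.Dvd s t → t ∉ X.Delta V := by
    rintro f s _ hf hl ⟨q, hq, rfl⟩ ⟨-, h⟩
    exact h (mem_sigma.2 ⟨f * X.phi q, Ideal.mul_mem_right _ _ hf, hl.mul (hasLead_phi hq)⟩)
  -- Substituting the message into `G_i` gives an element of `V` with the leading monomial of
  -- `G_i^D`.
  have hVD : X.Delta V ⊆ D := by
    intro t ht
    refine ⟨ht.1, fun f hf p hp hd => ?_⟩
    rw [isLM_down] at hp
    refine hVsigma (hVmem f hf) ?_ hd ht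
    rw [add_comm]
    exact hp.1.add_low (low_mono (by omega) (mul_mem_low hp.2 hνlow))
  have hE := Set.ncard_sdiff_add_ncard_of_subset hVD hD
  have hDG : X.DeltaGen (Prod.snd '' X.downPart k B) = D := DeltaGen_downPart k B
  -- After substitution of the message into `F_j`, the coefficient at `lm(F_j^U φ_k)` vanishes
  -- exactly when the vote is `w`. A wrong vote thus puts this monomial among the leading monomials
  -- of `V`.
  have hwrong : ∀ f ∈ X.upPart k B, X.vote k f ≠ w → ∀ t ∈ X.sigmaGen {f.1 * X.phi k},
      t ∉ X.Delta V := by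
    rintro f ⟨hf, p, hp⟩ hvote t ht
    rw [isLM_up] at hp
    have hlead := hp.1.mul (hasLead_phi hk)
    obtain ⟨_, rfl, -, hd⟩ := ht
    rw [hlead.delta_eq] at hd
    refine hVsigma (hVmem f hf) ⟨hlead.1, ?_, ?_⟩ hd
    · rw [hp.1.coeff_mul_add hk hμ]
      intro h0
      refine hvote ?_
      rw [vote_eq hk hp.1, ← neg_div, div_eq_iff hlead.2.1]
      exact (eq_neg_of_add_eq_zero_left h0).symm
    · refine Submodule.add_mem _ (low_mono ?_ (mul_mem_low hp.1.2.2 hνlow)) (low_mono ?_ hp.2)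
      · push_cast; omega
      · push_cast; omega
  have hle : ∀ c, c ≠ w → X.dc k B c ≤ (D \ X.Delta V).ncard := by
    intro c hc
    refine Set.ncard_le_ncard ?_ hD.sdiff
    intro t ht
    simp only [Set.mem_iUnion] at ht
    obtain ⟨f, ⟨hf, hv⟩, ht, htD⟩ := ht
    rw [hDG] at htD
    exact ⟨htD, hwrong f hf (hv ▸ hc) t ht⟩
  -- Here the Gröbner property is used: every `(0, f)` with `f ∈ J` belongs to the module.
  have hDJ : D ⊆ X.Delta (X.J P) := by
    intro t ht
    refine ⟨ht.1, fun hσ => ?_⟩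
    obtain ⟨f, hf, hl⟩ := mem_sigma.1 hσ
    refine (hGB (0, f) ?_ t).2 (isLM_down.2 ⟨hl, Submodule.zero_mem _⟩) ht
    rw [J_eq_vanishing, mem_vanishing] at hf
    intro i
    simp only
    rw [evalAt_zero, zero_mul, zero_add, hf i (Finset.mem_univ i)]
  set Z := ⋃ f ∈ {f | f ∈ X.upPart k B ∧ X.vote k f = w},
    X.sigmaGen {f.1 * X.phi k} ∩ X.DeltaGen (Prod.snd '' X.downPart k B) with hZ
  have hZfin : Z.Finite := hD.subset (by
    intro t ht
    simp only [hZ, Set.mem_iUnion] at ht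
    obtain ⟨f, -, -, htD⟩ := ht
    rwa [hDG] at htD)
  -- A multiple `φ_{k+q}` in `D` either has `q ∈ U`, or `φ_q z` is covered by some `F_j`, which
  -- votes for `w` or wrongly. Non-multiples of `φ_k` fall into the set bounded by `n - ν(k)`.
  have hcover : D ⊆ Z ∪ ((D \ X.Delta V) ∪
      ((X.Delta (X.J P) ∩ X.Delta (Ideal.span {X.phi k})) ∪ (· + k) '' U)) := by
    intro t ht
    by_cases hkt : X.Dvd k t
    · obtain ⟨q, hq, rfl⟩ := hkt
      by_cases hqU : q ∈ U
      · exact Or.inr (Or.inr (Or.inr ⟨q, hqU, add_comm q k⟩))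
      have : ∃ f ∈ B, ∃ p, X.IsLM k f (.up p) ∧ X.Dvd p q := by
        by_contra hno
        exact hqU ⟨hq, fun f hf p hp hd => hno ⟨f, hf, p, hp, hd⟩⟩
      obtain ⟨f, hf, p, hp, q', hq', rfl⟩ := this
      have hlead := (isLM_up.1 hp).1.mul (hasLead_phi hk)
      have hmem : k + (p + q') ∈ X.sigmaGen {f.1 * X.phi k} :=
        ⟨_, rfl, hlead.ne_zero, by rw [hlead.delta_eq]; exact ⟨q', hq', by omega⟩⟩
      by_cases hv : X.vote k f = w
      · left
        simp only [hZ, Set.mem_iUnion]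
        exact ⟨f, ⟨⟨hf, p, hp⟩, hv⟩, hmem, by rwa [hDG]⟩
      · exact Or.inr (Or.inl ⟨ht, hwrong f ⟨hf, p, hp⟩ hv _ hmem⟩)
    · exact Or.inr (Or.inr (Or.inl ⟨hDJ ht, (mem_Delta_span_phi hk).2 ⟨ht.1, hkt⟩⟩))
  have hJfin : (X.Delta (X.J P) ∩ X.Delta (Ideal.span {X.phi k})).Finite :=
    (Delta_J P).1.inter_of_left _
  have h1 := Set.ncard_le_ncard hcover
    (hZfin.union (hD.sdiff.union (hJfin.union (hU.image _))))
  have h2 := Set.ncard_union_le Z ((D \ X.Delta V) ∪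
    ((X.Delta (X.J P) ∩ X.Delta (Ideal.span {X.phi k})) ∪ (· + k) '' U))
  have h3 := Set.ncard_union_le (D \ X.Delta V)
    ((X.Delta (X.J P) ∩ X.Delta (Ideal.span {X.phi k})) ∪ (· + k) '' U)
  have h4 := Set.ncard_union_le (X.Delta (X.J P) ∩ X.Delta (Ideal.span {X.phi k})) ((· + k) '' U)
  have h5 := Set.ncard_image_le (f := (· + k)) hU
  have h6 := nu_add_ncard_inter_le P hk
  have hdc : X.dc k B w = Z.ncard := rfl
  -- The equality `|U| + |D| = n` makes `|U|` cancel between the two sides, leaving `2 wt(e) <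
  -- ν(k)`.
  have hlt : (D \ X.Delta V).ncard < X.dc k B w := by omega
  refine ⟨?_, fun c hc => (hle c hc).trans_lt hlt⟩
  have hne : Z.Nonempty := by
    rw [← Set.ncard_pos hZfin]
    omega
  obtain ⟨t, ht⟩ := hne
  simp only [hZ, Set.mem_iUnion] at ht
  obtain ⟨f, ⟨hf, hv⟩, -⟩ := ht
  exact ⟨f, hf, hv⟩

/-! ### Truncated messages -/

variable (X) in
/-- The part of the message function with monomials `φ_t`, `t ≤ s`. -/
def truncMessage (u : ℕ) (ω : ℕ → F) (s : ℤ) : X.R :=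
  ∑ t ∈ X.nongapsLE u, if (t : ℤ) ≤ s then ω t • X.phi t else 0

theorem truncMessage_mem_low (u : ℕ) (ω : ℕ → F) (s : ℤ) :
    X.truncMessage u ω s ∈ X.low (s + 1) := by
  refine Submodule.sum_mem _ fun t ht => ?_
  split_ifs with h
  · exact Submodule.smul_mem _ _ (phi_mem_low (mem_nongapsLE.1 ht).1 (by omega))
  · exact Submodule.zero_mem _

theorem truncMessage_eq_message {u : ℕ} {ω : ℕ → F} {s : ℤ}
    (h : ∀ t ∈ X.S, t ≤ u → s < t → ω t = 0) : X.truncMessage u ω s = X.message u ω := by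
  refine Finset.sum_congr rfl fun t ht => ?_
  rw [const_mul]
  split_ifs with hts
  · rfl
  · have ht := mem_nongapsLE.1 ht
    rw [h t ht.1 ht.2 (by omega), zero_smul]

theorem message_eq_truncMessage (u : ℕ) (ω : ℕ → F) :
    X.message u ω = X.truncMessage u ω u :=
  (truncMessage_eq_message fun t _ htu hlt => by omega).symm

theorem truncMessage_of_mem {u k : ℕ} (ω : ℕ → F) (hk : k ∈ X.S) (hku : k ≤ u) :
    X.truncMessage u ω k = X.truncMessage u ω (k - 1) + ω k • X.phi k := by
  classical
  have hmem : k ∈ X.nongapsLE u := mem_nongapsLE.2 ⟨hk, hku⟩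
  rw [truncMessage, truncMessage, ← Finset.add_sum_erase _ _ hmem, ← Finset.add_sum_erase _ _ hmem,
    if_pos le_rfl, if_neg (by omega), zero_add, add_comm]
  congr 1
  refine Finset.sum_congr rfl fun t ht => ?_
  have hne := Finset.ne_of_mem_erase ht
  by_cases h : (t : ℤ) ≤ k
  · rw [if_pos h, if_pos (by omega)]
  · rw [if_neg h, if_neg (by omega)]

theorem truncMessage_of_notMem {u k : ℕ} (ω : ℕ → F) (hk : ¬ (k ∈ X.S ∧ k ≤ u)) :
    X.truncMessage u ω k = X.truncMessage u ω (k - 1) := by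
  refine Finset.sum_congr rfl fun t ht => ?_
  have hne : t ≠ k := by
    rintro rfl
    exact hk (mem_nongapsLE.1 ht)
  by_cases h : (t : ℤ) ≤ k
  · rw [if_pos h, if_pos (by omega)]
  · rw [if_neg h, if_neg (by omega)]

theorem coeff_message {u : ℕ} (ω : ℕ → F) {t : ℕ} (ht : t ∈ X.S) (htu : t ≤ u) :
    X.coeff (X.message u ω) t = ω t := by
  rw [message, ← coeffHom_apply, map_sum, Finset.sum_apply,
    Finset.sum_eq_single_of_mem t (mem_nongapsLE.2 ⟨ht, htu⟩)]
  · rw [coeffHom_apply, const_mul, coeff_smul, X.coeff_phi ht ht, if_pos rfl, mul_one]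
  · intro s hs hst
    rw [coeffHom_apply, const_mul, coeff_smul, X.coeff_phi (mem_nongapsLE.1 hs).1 ht,
      if_neg hst.symm, mul_zero]

/-! ### The invariant of the algorithm -/

variable (P) in
/-- The properties of the states that the algorithm passes through: the basis is a Gröbner basis
of the interpolation module of the error plus the part of the message that is still unknown, and
all the guesses so far are correct. -/
structure Invariant (u : ℕ) (ω : ℕ → F) (e : Fin n → F) (σ : X.State) : Prop where
  subset : σ.B ⊆ interp P fun i => e i + X.evalAt (P i) (X.truncMessage u ω σ.s)
  up_finite : (X.upDelta σ.s σ.B).Finite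
  down_finite : (X.downDelta σ.s σ.B).Finite
  ncard_le : (X.upDelta σ.s σ.B).ncard + (X.downDelta σ.s σ.B).ncard ≤ n
  guess : ∀ t ∈ X.S, t ≤ u → σ.s < t → σ.w t = ω t

/-- Otherwise `message - h` would have the leading monomial of the message, of index at most `u`,
and hence value weight at least `d_u`; but its value is `-e`. This justifies the default guess `0`
above the starting index. -/
theorem eq_zero_of_ev_eq [DecidableEq F] {u : ℕ} {ω : ℕ → F} {e : Fin n → F}
    (he : 2 * (hammingNorm e : ℤ) < X.du P u) {h : X.R}
    (hh : X.ev P h = X.ev P (X.message u ω) + e) {s : ℤ} (hs : h ∈ X.low (s + 1)) :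
    ∀ t ∈ X.S, t ≤ u → s < t → ω t = 0 := by
  intro t ht htu hst
  by_contra h0
  have hc : X.coeff (X.message u ω) t ≠ 0 := by rwa [coeff_message ω ht htu]
  have hne : X.message u ω ≠ 0 := fun h1 => hc (by rw [h1, X.coeff_zero])
  have hl := hasLead_delta hne
  have h1 := hl.2.2 t ht hc
  have hlow : X.message u ω ∈ X.low (u + 1) := by
    rw [message_eq_truncMessage]
    exact truncMessage_mem_low u ω u
  have h2 := hlow _ hl.1 hl.2.1
  have h3 := nu_le_hammingNorm (P := P) (hl.sub_low (low_mono (by omega) hs))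
  have h4 := du_le_nu P hl.1 (by omega : X.delta (X.message u ω) ≤ u)
  have h5 : X.ev P (X.message u ω - h) = -e := by
    funext i
    have := congrFun hh i
    simp only [ev, Pi.add_apply, Pi.neg_apply] at this ⊢
    rw [evalAt_sub, this]
    ring
  have h6 : hammingNorm (-e) = hammingNorm e := by simp [hammingNorm]
  rw [h5, h6] at h3
  omega

/-- The leading monomial of `z - h` is `z`, so nothing is missing in `Rz`; in `R` at most the `n`
elements of `Δ(J)` are. -/
theorem Invariant.of_isInit [DecidableEq F] {u : ℕ} {ω : ℕ → F} {e v : Fin n → F}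
    (hv : v = X.ev P (X.message u ω) + e) (he : 2 * (hammingNorm e : ℤ) < X.du P u)
    {σ : X.State} (h : X.IsInit P v σ) : Invariant P u ω e σ := by
  obtain ⟨h, η, hh, -, hη, hB, hs, hw⟩ := h
  have hlow : h ∈ X.low (σ.s + 1) := by
    rcases hs with ⟨rfl, -⟩ | ⟨h0, hs⟩
    · exact Submodule.zero_mem _
    · rw [hs]; exact (hasLead_delta h0).2.2
  have hω := eq_zero_of_ev_eq he (hh.trans hv) hlow
  have hup : X.upDelta σ.s σ.B = ∅ := by
    rw [Set.eq_empty_iff_forall_notMem]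
    rintro t ⟨ht, h1⟩
    have hl : X.HasLead (1 : X.R) 0 := by
      have := hasLead_phi X.zero_mem_S
      have e1 : X.phi 0 = 1 := by
        have := X.phi_eq 0 X.a_pos
        simpa using this
      rwa [e1] at this
    refine h1 ((1 : X.R), -h) (hB ▸ Or.inr rfl) 0 (isLM_up.2 ⟨hl, Submodule.neg_mem _ ?_⟩)
      ⟨t, ht, by omega⟩
    exact low_mono (by push_cast; omega) hlow
  have hdown : X.downDelta σ.s σ.B ⊆ X.Delta (X.J P) := by
    rintro t ⟨ht, h1⟩
    refine ⟨ht, ?_⟩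
    rintro ⟨f, hf, h0, rfl⟩
    obtain ⟨g, hg, hd⟩ := hη.2 f hf h0
    exact h1 (0, g) (hB ▸ Or.inl ⟨g, hg, rfl⟩) _
      (isLM_down.2 ⟨hasLead_delta (hη.1 g hg).2, Submodule.zero_mem _⟩) hd
  have hJ := Delta_J P
  refine ⟨?_, hup ▸ Set.finite_empty, hJ.1.subset hdown, ?_, ?_⟩
  · rw [hB, truncMessage_eq_message hω]
    rintro _ (⟨g, hg, rfl⟩ | rfl)
    · have := (hη.1 g hg).1
      rw [J_eq_vanishing, mem_vanishing] at this
      intro i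
      simp only
      rw [evalAt_zero, zero_mul, zero_add, this i (Finset.mem_univ i)]
    · intro i
      have h1 : X.evalAt (P i) h = X.evalAt (P i) (X.message u ω) + e i :=
        congrFun (hh.trans hv) i
      simp only
      rw [evalAt_one, evalAt_neg, h1]
      ring
  · have := Set.ncard_le_ncard hdown hJ.1
    rw [hJ.2] at this
    rwa [hup, Set.ncard_empty, zero_add]
  · intro t ht htu hst
    rw [hw, hω t ht htu hst]
    rfl

theorem Invariant.vote_majority [DecidableEq F] {u : ℕ} {ω : ℕ → F} {e : Fin n → F}
    (he : 2 * (hammingNorm e : ℤ) < X.du P u) {σ : X.State} (h : Invariant P u ω e σ) {k : ℕ}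
    (hs : σ.s = k) (hk : k ∈ X.S) (hku : k ≤ u) :
    ω k ∈ X.W k σ.B ∧ ∀ c, c ≠ ω k → X.dc k σ.B c < X.dc k σ.B (ω k) := by
  obtain ⟨hB, hU, hD, hc, -⟩ := h
  rw [hs] at hB hU hD hc
  rw [truncMessage_of_mem ω hk hku] at hB
  have hlow := truncMessage_mem_low (X := X) u ω (k - 1)
  rw [sub_add_cancel] at hlow
  exact MiuraKamiyaCurve.vote_majority hk hlow (he.trans_le (du_le_nu P hk hku)) hB hU hD hc

theorem Invariant.exists_step [DecidableEq F] {u : ℕ} {ω : ℕ → F} {e : Fin n → F}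
    (he : 2 * (hammingNorm e : ℤ) < X.du P u) {σ : X.State} (h : Invariant P u ω e σ)
    (hs : 0 ≤ σ.s) : ∃ σ', X.Step u σ σ' := by
  obtain ⟨k, hk⟩ := Int.eq_ofNat_of_zero_le hs
  by_cases hkS : k ∈ X.S ∧ k ≤ u
  · obtain ⟨hW, hmax⟩ := h.vote_majority he hk hkS.1 hkS.2
    obtain ⟨B', hB'⟩ := exists_isUpdate k (X.shift k (ω k) '' σ.B)
    refine ⟨⟨k - 1, B', Function.update σ.w k (ω k)⟩, k, _, hk, rfl,
      Or.inl ⟨hkS.1, hkS.2, ω k, ⟨hW, fun c _ => ?_⟩, rfl, rfl⟩, hB'⟩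
    by_cases hc : c = ω k
    · rw [hc]
    · exact (hmax c hc).le
  · obtain ⟨B', hB'⟩ := exists_isUpdate k σ.B
    exact ⟨⟨k - 1, B', σ.w⟩, k, _, hk, rfl, Or.inr ⟨hkS, rfl, rfl⟩, hB'⟩

theorem Invariant.step [DecidableEq F] {u : ℕ} {ω : ℕ → F} {e : Fin n → F}
    (he : 2 * (hammingNorm e : ℤ) < X.du P u) {σ σ' : X.State} (h : Invariant P u ω e σ)
    (hstep : X.Step u σ σ') : Invariant P u ω e σ' := by
  obtain ⟨k, B, hs, hs', hcase, hupd⟩ := hstep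
  -- Step M2 is the same with or without a guess, so it is treated once; what remains concerns M1
  -- only.
  suffices hsuff : B ⊆ interp P (fun i => e i + X.evalAt (P i) (X.truncMessage u ω (k - 1))) ∧
      X.upDelta k B ⊆ X.upDelta k σ.B ∧ X.downDelta k B ⊆ X.downDelta k σ.B ∧
      ∀ t ∈ X.S, t ≤ u → ((k : ℤ) - 1) < t → σ'.w t = ω t by
    obtain ⟨hB, hUs, hDs, hw⟩ := hsuff
    have hU := h.up_finite
    have hD := h.down_finite
    have hc := h.ncard_le
    rw [hs] at hU hD hc
    obtain ⟨hU', hD', hc'⟩ := hupd.ncard_le (hU.subset hUs) (hD.subset hDs)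
    have h1 := Set.ncard_le_ncard hUs hU
    have h2 := Set.ncard_le_ncard hDs hD
    refine ⟨?_, ?_, ?_, ?_, ?_⟩ <;> rw [hs']
    · exact hupd.subset hB
    · exact hU'
    · exact hD'
    · omega
    · exact hw
  have hB := h.subset
  have hg := h.guess
  rw [hs] at hB hg
  rcases hcase with ⟨hk, hku, c, hc, rfl, hw⟩ | ⟨hk, rfl, hw⟩
  -- The maximum is strict, so ties leave no freedom and every admissible guess is the true
  -- coefficient.
  · have hcω : c = ω k := by
      obtain ⟨hW, hmax⟩ := h.vote_majority he hs hk hku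
      by_contra hne
      exact absurd (hc.2 _ hW) (not_le.2 (hmax c hne))
    subst hcω
    refine ⟨?_, upDelta_shift_subset hk _ _, downDelta_shift_subset hk _ _, ?_⟩
    · rw [truncMessage_of_mem ω hk hku] at hB
      rintro _ ⟨f, hf, rfl⟩
      exact shift_mem_interp (hB hf)
    · intro t ht htu hlt
      rw [hw]
      by_cases htk : t = k
      · rw [htk, Function.update_self]
      · rw [Function.update_of_ne htk]
        exact hg t ht htu (by omega)
  · refine ⟨?_, subset_rfl, subset_rfl, ?_⟩
    · rwa [truncMessage_of_notMem ω hk] at hB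
    · intro t ht htu hlt
      rw [hw]
      have htk : t ≠ k := by rintro rfl; exact hk ⟨ht, htu⟩
      exact hg t ht htu (by omega)

end MiuraKamiyaCurve
end

/-! ### Induction along an arbitrary run of the algorithm -/

theorem mainTheorem1 {F : Type*} [Field F] [DecidableEq F] (X : MiuraKamiyaCurve F)
    {n : ℕ} (P : Fin n ↪ X.Point) (u : ℕ) (hu : u < n) :
    (n : ℤ) - u ≤ X.du P u ∧
    ∀ (ω : ℕ → F) (e v : Fin n → F), v = X.ev P (X.message u ω) + e →
      2 * (hammingNorm e : ℤ) < X.du P u →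
      (∃ σ, X.IsInit P v σ) ∧
      ∀ σ₀, X.IsInit P v σ₀ → ∀ σ, Relation.ReflTransGen (X.Step u) σ₀ σ →
        (0 ≤ σ.s → ∃ σ', X.Step u σ σ') ∧
        (σ.s < 0 → ∀ s ∈ X.S, s ≤ u → σ.w s = ω s) := by
  refine ⟨MiuraKamiyaCurve.sub_le_du P u, fun ω e v hv he =>
    ⟨MiuraKamiyaCurve.exists_isInit v, fun σ₀ h₀ σ hσ => ?_⟩⟩
  have hinv : MiuraKamiyaCurve.Invariant P u ω e σ := by
    induction hσ with
    | refl => exact MiuraKamiyaCurve.Invariant.of_isInit hv he h₀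
    | tail _ hstep ih => exact ih.step he hstep
  exact ⟨hinv.exists_step he, fun hs t ht htu => hinv.guess t ht htu (by omega)⟩
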